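/- Let $\mathscr C$ be a category with finite limits, and let $\mathcal F=(\mathcal E,\mathcal M)$ be an orthogonal factorization system on $\mathscr C$ (both classes contain the isomorphisms and are closed under composition, every arrow factors as an $\mathcal E$-arrow followed by an $\mathcal M$-arrow, and every commutative square from an $\mathcal E$-arrow to an $\mathcal M$-arrow has a unique diagonal filler) that is stable ($\mathcal E$ is closed under pullback) and proper (arrows in $\mathcal E$ are epimorphisms, arrows in $\mathcal M$ are monomorphisms). An $\mathcal F$-relation $R\colon A\nrightarrow B$ is a span $A\xleftarrow{l}R\xrightarrow{r}B$ such that $\langle l,r\rangle\colon R\to A\times B$ is in $\mathcal M$. A cell from $R\colon A\nrightarrow B$ to $S\colon C\nrightarrow D$ with sides $f\colon A\to C$ and $g\colon B\to D$ is a morphism of spans $R\to S$ over $f$ and $g$. The external composite $R\otimes S\colon A\nrightarrow C$ of $R\colon A\nrightarrow B$ and $S\colon B\nrightarrow C$ (diagrammatic order) is the $\mathcal M$-part of the $\mathcal F$-factorization of $R\times_BS\to A\times C$, the external composite of cells is the one induced by functoriality of pullbacks and of $\mathcal F$-factorizations, and the external identity $y_A$ is the span of identities on $A$. Then: 1. With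 these operations, objects and arrows of $\mathscr C$, $\mathcal F$-relations and cells form a pseudo double category $\mathbb R\mathbf{el}(\mathscr C;\mathcal F)=\mathbb D$, with $\mathbb D_0=\mathscr C$. 2. $\mathbb D$ is unit-pure, that is, $y\colon\mathbb D_0\to\mathbb D_1$ is full. It is an equipment: every arrow $f\colon A\to B$ has a companion $f_!\colon A\nrightarrow B$ and a conjoint $f^*\colon B\nrightarrow A$. It is cartesian: the double functors $\mathbb D\to\mathbb D\times\mathbb D$ and $\mathbb D\to\mathbf 1$ have right adjoints in the 2-category of double categories, (pseudo) double functors and vertical transformations. Every category $\mathbb D(A,B)$ of proarrows $A\nrightarrow B$ and globular cells has finite products; binary ones are written $\wedge$. 3. $\mathbb D$ has tabulators, that is, $y\colon\mathbb D_0\to\mathbb D_1$ has a right adjoint $\top$; and the unit of $y\dashv\top$ is invertible. 4. Let $m\colon A\nrightarrow B$ be a proarrow of $\mathbb D$ with tabulator given by the counit cell $y_{\top m}\Rightarrow m$ with sides $l\colon\top m\to A$ and $r\colon\top m\to B$. Then the tabulator is strong: the canonical cell $l^*\otimes r_!\Rightarrow m$ is invertible. Its legs are jointly an inclusion: $\langle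 l,r\rangle\colon\top m\to A\times B$ is in $\mathcal M$. And $$(l_!\otimes l^*)\wedge(r_!\otimes r^*)\;\cong\;y_{\top m}$$ canonically: the cell from $y_{\top m}$ to the local product that is induced by the canonical cells $y_{\top m}\Rightarrow l_!\otimes l^*$ and $y_{\top m}\Rightarrow r_!\otimes r^*$ is invertible. -/

import Mathlib

set_option linter.checkUnivs false

open CategoryTheory CategoryTheory.Limits

universe v u w z v₁ u₁ w₁ z₁ v₂ u₂ w₂ z₂ v₃ u₃ w₃ z₃

/-! ## Pseudo double categories -/

/-- Proarrows `A ⇸ B` and cells over a category of objects and arrows.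
`Cell m n f g` is the type of cells with top `m`, bottom `n`, left side `f`, right side `g`. -/
structure ProSystem (D₀ : Type u) [Category.{v} D₀] where
  Pro : D₀ → D₀ → Type w
  Cell : ∀ {A B C D : D₀}, Pro A B → Pro C D → (A ⟶ C) → (B ⟶ D) → Type z

namespace ProSystem

variable {D₀ : Type u} [Category.{v} D₀]

/-- A cell together with its two sides; these are the morphisms `m ⟶ n` of the category `D₁`. -/
structure Sq (X : ProSystem.{v, u, w, z} D₀) {A B C D : D₀} (m : X.Pro A B) (n : X.Pro C D) where
  left : A ⟶ C
  right : B ⟶ D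
  cell : X.Cell m n left right

/-- Equality of two cells as morphisms of `D₁`. (Their sides are equal, but possibly not
definitionally, such as `𝟙 A ≫ f` and `f`.) -/
def EqCell {X : ProSystem.{v, u, w, z} D₀} {A B C D : D₀} {m : X.Pro A B} {n : X.Pro C D}
    {f f' : A ⟶ C} {g g' : B ⟶ D} (α : X.Cell m n f g) (β : X.Cell m n f' g') : Prop :=
  (⟨f, g, α⟩ : X.Sq m n) = ⟨f', g', β⟩

/-- Transport of a cell along equalities of its sides. -/
def castCell {X : ProSystem.{v, u, w, z} D₀} {A B C D : D₀} {m : X.Pro A B} {n : X.Pro C D}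
    {f f' : A ⟶ C} {g g' : B ⟶ D} (hf : f = f') (hg : g = g') (α : X.Cell m n f g) :
    X.Cell m n f' g' :=
  cast (by rw [hf, hg]) α

end ProSystem

open ProSystem

/-- The operations of a double category, without laws and without coherence cells.
External composition `hcompPro m n` is written in diagrammatic order. -/
structure DoubleData (D₀ : Type u) [Category.{v} D₀] extends ProSystem.{v, u, w, z} D₀ where
  vid : ∀ {A B : D₀} (m : Pro A B), Cell m m (𝟙 A) (𝟙 B)
  vcomp : ∀ {A B C D E G : D₀} {m : Pro A B} {n : Pro C D} {p : Pro E G}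
    {f : A ⟶ C} {g : B ⟶ D} {f' : C ⟶ E} {g' : D ⟶ G},
    Cell m n f g → Cell n p f' g' → Cell m p (f ≫ f') (g ≫ g')
  unit : ∀ A : D₀, Pro A A
  unitCell : ∀ {A B : D₀} (f : A ⟶ B), Cell (unit A) (unit B) f f
  hcompPro : ∀ {A B C : D₀}, Pro A B → Pro B C → Pro A C
  hcomp : ∀ {A B C A' B' C' : D₀} {m : Pro A B} {n : Pro B C} {m' : Pro A' B'} {n' : Pro B' C'}
    {f : A ⟶ A'} {g : B ⟶ B'} {h : C ⟶ C'},
    Cell m m' f g → Cell n n' g h → Cell (hcompPro m n) (hcompPro m' n') f h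

/-- Invertible globular cells. -/
structure DoubleData.GlobIso {D₀ : Type u} [Category.{v} D₀] (X : DoubleData.{v, u, w, z} D₀)
    {A B : D₀} (m n : X.Pro A B) where
  hom : X.Cell m n (𝟙 A) (𝟙 B)
  inv : X.Cell n m (𝟙 A) (𝟙 B)
  hom_inv : EqCell (X.vcomp hom inv) (X.vid m)
  inv_hom : EqCell (X.vcomp inv hom) (X.vid n)

/-- Coherence isomorphisms and laws that make the operations of `X` a pseudo double category. -/
structure DoubleData.Coherence {D₀ : Type u} [Category.{v} D₀] (X : DoubleData.{v, u, w, z} D₀)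
    where
  vid_vcomp : ∀ {A B C D : D₀} {m : X.Pro A B} {n : X.Pro C D} {f : A ⟶ C} {g : B ⟶ D}
    (α : X.Cell m n f g), EqCell (X.vcomp (X.vid m) α) α
  vcomp_vid : ∀ {A B C D : D₀} {m : X.Pro A B} {n : X.Pro C D} {f : A ⟶ C} {g : B ⟶ D}
    (α : X.Cell m n f g), EqCell (X.vcomp α (X.vid n)) α
  vassoc : ∀ {A B C D E G H K : D₀} {m : X.Pro A B} {n : X.Pro C D} {p : X.Pro E G} {q : X.Pro H K}
    {f : A ⟶ C} {g : B ⟶ D} {f' : C ⟶ E} {g' : D ⟶ G} {f'' : E ⟶ H} {g'' : G ⟶ K}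
    (α : X.Cell m n f g) (β : X.Cell n p f' g') (γ : X.Cell p q f'' g''),
    EqCell (X.vcomp (X.vcomp α β) γ) (X.vcomp α (X.vcomp β γ))
  unitCell_id : ∀ A : D₀, X.unitCell (𝟙 A) = X.vid (X.unit A)
  unitCell_comp : ∀ {A B C : D₀} (f : A ⟶ B) (g : B ⟶ C),
    X.unitCell (f ≫ g) = X.vcomp (X.unitCell f) (X.unitCell g)
  hcomp_vid : ∀ {A B C : D₀} (m : X.Pro A B) (n : X.Pro B C),
    X.hcomp (X.vid m) (X.vid n) = X.vid (X.hcompPro m n)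
  interchange : ∀ {A B C A' B' C' A'' B'' C'' : D₀} {m : X.Pro A B} {n : X.Pro B C}
    {m' : X.Pro A' B'} {n' : X.Pro B' C'} {m'' : X.Pro A'' B''} {n'' : X.Pro B'' C''}
    {f : A ⟶ A'} {g : B ⟶ B'} {h : C ⟶ C'} {f' : A' ⟶ A''} {g' : B' ⟶ B''} {h' : C' ⟶ C''}
    (α : X.Cell m m' f g) (β : X.Cell n n' g h) (α' : X.Cell m' m'' f' g') (β' : X.Cell n' n'' g' h'),
    X.hcomp (X.vcomp α α') (X.vcomp β β') = X.vcomp (X.hcomp α β) (X.hcomp α' β')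
  assoc : ∀ {A B C D : D₀} (m : X.Pro A B) (n : X.Pro B C) (p : X.Pro C D),
    X.GlobIso (X.hcompPro (X.hcompPro m n) p) (X.hcompPro m (X.hcompPro n p))
  leftUnitor : ∀ {A B : D₀} (m : X.Pro A B), X.GlobIso (X.hcompPro (X.unit A) m) m
  rightUnitor : ∀ {A B : D₀} (m : X.Pro A B), X.GlobIso (X.hcompPro m (X.unit B)) m
  assoc_natural : ∀ {A B C D A' B' C' D' : D₀} {m : X.Pro A B} {n : X.Pro B C} {p : X.Pro C D}
    {m' : X.Pro A' B'} {n' : X.Pro B' C'} {p' : X.Pro C' D'}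
    {f : A ⟶ A'} {g : B ⟶ B'} {h : C ⟶ C'} {k : D ⟶ D'}
    (α : X.Cell m m' f g) (β : X.Cell n n' g h) (γ : X.Cell p p' h k),
    EqCell (X.vcomp (X.hcomp (X.hcomp α β) γ) (assoc m' n' p').hom)
      (X.vcomp (assoc m n p).hom (X.hcomp α (X.hcomp β γ)))
  leftUnitor_natural : ∀ {A B A' B' : D₀} {m : X.Pro A B} {m' : X.Pro A' B'}
    {f : A ⟶ A'} {g : B ⟶ B'} (α : X.Cell m m' f g),
    EqCell (X.vcomp (X.hcomp (X.unitCell f) α) (leftUnitor m').hom) (X.vcomp (leftUnitor m).hom α)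
  rightUnitor_natural : ∀ {A B A' B' : D₀} {m : X.Pro A B} {m' : X.Pro A' B'}
    {f : A ⟶ A'} {g : B ⟶ B'} (α : X.Cell m m' f g),
    EqCell (X.vcomp (X.hcomp α (X.unitCell g)) (rightUnitor m').hom) (X.vcomp (rightUnitor m).hom α)
  pentagon : ∀ {A B C D E : D₀} (m : X.Pro A B) (n : X.Pro B C) (p : X.Pro C D) (q : X.Pro D E),
    EqCell (X.vcomp (X.hcomp (assoc m n p).hom (X.vid q))
        (X.vcomp (assoc m (X.hcompPro n p) q).hom (X.hcomp (X.vid m) (assoc n p q).hom)))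
      (X.vcomp (assoc (X.hcompPro m n) p q).hom (assoc m n (X.hcompPro p q)).hom)
  triangle : ∀ {A B C : D₀} (m : X.Pro A B) (n : X.Pro B C),
    EqCell (X.vcomp (assoc m (X.unit B) n).hom (X.hcomp (X.vid m) (leftUnitor n).hom))
      (X.hcomp (rightUnitor m).hom (X.vid n))

/-- A pseudo double category with category of objects and arrows `D₀`. -/
structure DoubleCat (D₀ : Type u) [Category.{v} D₀] extends DoubleData.{v, u, w, z} D₀ where
  coh : toDoubleData.Coherence

namespace DoubleCat

section Basic

variable {D₀ : Type u} [Category.{v} D₀] (D : DoubleCat.{v, u, w, z} D₀)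

/-- Objects of the category `D₁` of proarrows and cells. -/
structure Proarrow where
  src : D₀
  tgt : D₀
  pro : D.Pro src tgt

/-- The category `D₁` of proarrows and cells. -/
instance : Category D.Proarrow where
  Hom m n := D.Sq m.pro n.pro
  id m := ⟨𝟙 _, 𝟙 _, D.vid m.pro⟩
  comp s t := ⟨s.left ≫ t.left, s.right ≫ t.right, D.vcomp s.cell t.cell⟩
  id_comp s := D.coh.vid_vcomp s.cell
  comp_id s := D.coh.vcomp_vid s.cell
  assoc s t r := D.coh.vassoc s.cell t.cell r.cell

/-- The external identity functor `y : D₀ ⥤ D₁`. -/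
def y : D₀ ⥤ D.Proarrow where
  obj A := ⟨A, A, D.unit A⟩
  map f := ⟨f, f, D.unitCell f⟩
  map_id A := by
    rw [D.coh.unitCell_id A]; rfl
  map_comp f g := by
    rw [D.coh.unitCell_comp f g]; rfl

/-- `D` is unit-pure if `y` is full. -/
def IsUnitPure : Prop := D.y.Full

/-- `D` has tabulators if `y` has a right adjoint. -/
def HasTabulators : Prop := D.y.IsLeftAdjoint

/-- Objects of the category `D(A, B)`: proarrows `A ⇸ B`. -/
structure Hor (A B : D₀) where
  pro : D.Pro A B

/-- The category `D(A, B)` of proarrows `A ⇸ B` and globular cells, that is, cells whose sides are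
identities. -/
instance (A B : D₀) : Category (D.Hor A B) where
  Hom m n := { s : D.Sq m.pro n.pro // s.left = 𝟙 A ∧ s.right = 𝟙 B }
  id m := ⟨⟨𝟙 _, 𝟙 _, D.vid m.pro⟩, rfl, rfl⟩
  comp s t := ⟨⟨s.1.left ≫ t.1.left, s.1.right ≫ t.1.right, D.vcomp s.1.cell t.1.cell⟩,
    by simp [s.2.1, t.2.1], by simp [s.2.2, t.2.2]⟩
  id_comp s := Subtype.ext (D.coh.vid_vcomp s.1.cell)
  comp_id s := Subtype.ext (D.coh.vcomp_vid s.1.cell)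
  assoc s t r := Subtype.ext (D.coh.vassoc s.1.cell t.1.cell r.1.cell)

/-- A cell whose sides are equal to identities, as a morphism of `D(A, B)`. -/
def globular {A B : D₀} {m n : D.Pro A B} {f : A ⟶ A} {g : B ⟶ B} (α : D.Cell m n f g)
    (hf : f = 𝟙 A) (hg : g = 𝟙 B) : (⟨m⟩ : D.Hor A B) ⟶ ⟨n⟩ :=
  ⟨⟨f, g, α⟩, hf, hg⟩

/-- `D` has local products if every category `D(A, B)` has finite products. -/
def HasLocalProducts : Prop := ∀ A B : D₀, HasFiniteProducts (D.Hor A B)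

/-- A companion `f_! : A ⇸ B` of an arrow `f : A ⟶ B`. -/
structure Companion {A B : D₀} (f : A ⟶ B) where
  pro : D.Pro A B
  η : D.Cell (D.unit A) pro (𝟙 A) f
  ε : D.Cell pro (D.unit B) f (𝟙 B)
  /-- `η ⊗ ε = 1`, up to the unit isomorphisms. -/
  hcomp_eq : EqCell (D.vcomp (D.hcomp η ε) (D.coh.rightUnitor pro).hom) (D.coh.leftUnitor pro).hom
  vcomp_eq : EqCell (D.vcomp η ε) (D.unitCell f)

/-- A conjoint `f^* : B ⇸ A` of an arrow `f : A ⟶ B`. -/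
structure Conjoint {A B : D₀} (f : A ⟶ B) where
  pro : D.Pro B A
  ε : D.Cell pro (D.unit B) (𝟙 B) f
  η : D.Cell (D.unit A) pro f (𝟙 A)
  /-- `ε ⊗ η = 1`, up to the unit isomorphisms. -/
  hcomp_eq : EqCell (D.vcomp (D.hcomp ε η) (D.coh.leftUnitor pro).hom) (D.coh.rightUnitor pro).hom
  vcomp_eq : EqCell (D.vcomp η ε) (D.unitCell f)

/-- `D` is an equipment if every arrow has a companion and a conjoint. -/
def IsEquipment : Prop :=
  ∀ {A B : D₀} (f : A ⟶ B), Nonempty (D.Companion f) ∧ Nonempty (D.Conjoint f)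

variable {D}

/-- For a cell `τ : y_T ⇒ m` with sides `l` and `r`, the induced globular cell
`l^* ⊗ r_! ≅ l^* ⊗ (y_T ⊗ r_!) ⇒ y_A ⊗ (m ⊗ y_B) ≅ m` out of the canonical extension of `l`, `r`. -/
def fromExtension {T A B : D₀} {m : D.Pro A B} {l : T ⟶ A} {r : T ⟶ B}
    (τ : D.Cell (D.unit T) m l r) (cl : D.Conjoint l) (cr : D.Companion r) :
    (⟨D.hcompPro cl.pro cr.pro⟩ : D.Hor A B) ⟶ ⟨m⟩ :=
  D.globular (D.hcomp (D.vid cl.pro) (D.coh.leftUnitor cr.pro).inv) rfl rfl ≫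
    D.globular (D.hcomp cl.ε (D.hcomp τ cr.ε)) rfl rfl ≫
      D.globular (D.coh.leftUnitor (D.hcompPro m (D.unit B))).hom rfl rfl ≫
        D.globular (D.coh.rightUnitor m).hom rfl rfl

/-- A cell `τ : y_T ⇒ m` with sides `l` and `r` exhibits `m` as the canonical extension
`l^* ⊗ r_!`. -/
def IsCanonicalExtension {T A B : D₀} {m : D.Pro A B} {l : T ⟶ A} {r : T ⟶ B}
    (τ : D.Cell (D.unit T) m l r) : Prop :=
  ∀ (cl : D.Conjoint l) (cr : D.Companion r), IsIso (fromExtension τ cl cr)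

/-- The canonical globular cell `y_T ≅ y_T ⊗ y_T ⇒ f_! ⊗ f^*` into the kernel of `f : T ⟶ A`. -/
def toKernel {T A : D₀} {f : T ⟶ A} (c : D.Companion f) (c' : D.Conjoint f) :
    (⟨D.unit T⟩ : D.Hor T T) ⟶ ⟨D.hcompPro c.pro c'.pro⟩ :=
  D.globular (D.coh.leftUnitor (D.unit T)).inv rfl rfl ≫ D.globular (D.hcomp c.η c'.η) rfl rfl

/-- Arrows `l : T ⟶ A` and `r : T ⟶ B` satisfy `(l_! ⊗ l^*) ∧ (r_! ⊗ r^*) ≅ y_T` canonically: the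
canonical cell from `y_T` to the local product is invertible. -/
def JointKernelTrivial (D : DoubleCat.{v, u, w, z} D₀) {T A B : D₀} (l : T ⟶ A) (r : T ⟶ B) :
    Prop :=
  ∀ (cl : D.Companion l) (cl' : D.Conjoint l) (cr : D.Companion r) (cr' : D.Conjoint r)
    (P : BinaryFan (⟨D.hcompPro cl.pro cl'.pro⟩ : D.Hor T T) ⟨D.hcompPro cr.pro cr'.pro⟩)
    (hP : IsLimit P), IsIso (hP.lift (BinaryFan.mk (toKernel cl cl') (toKernel cr cr')))

end Basic

/-! ### Double functors, transformations and adjunctions -/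

section Functors

variable {D₀ : Type u₁} [Category.{v₁} D₀] {E₀ : Type u₂} [Category.{v₂} E₀]
  {K₀ : Type u₃} [Category.{v₃} K₀]

/-- The operations of a (pseudo) double functor, with comparison cells `F m ⊗ F n ⇒ F (m ⊗ n)` and
`y_{F A} ⇒ F y_A`. -/
structure FunctorData (D : DoubleCat.{v₁, u₁, w₁, z₁} D₀) (E : DoubleCat.{v₂, u₂, w₂, z₂} E₀) where
  obj : D₀ ⥤ E₀
  pro : ∀ {A B : D₀}, D.Pro A B → E.Pro (obj.obj A) (obj.obj B)
  cell : ∀ {A B C G : D₀} {m : D.Pro A B} {n : D.Pro C G} {f : A ⟶ C} {g : B ⟶ G},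
    D.Cell m n f g → E.Cell (pro m) (pro n) (obj.map f) (obj.map g)
  compCell : ∀ {A B C : D₀} (m : D.Pro A B) (n : D.Pro B C),
    E.Cell (E.hcompPro (pro m) (pro n)) (pro (D.hcompPro m n)) (𝟙 _) (𝟙 _)
  idCell : ∀ A : D₀, E.Cell (E.unit (obj.obj A)) (pro (D.unit A)) (𝟙 _) (𝟙 _)

/-- The identity double functor. -/
def FunctorData.id (D : DoubleCat.{v₁, u₁, w₁, z₁} D₀) : FunctorData D D where
  obj := 𝟭 D₀
  pro m := m
  cell α := α
  compCell m n := D.vid (D.hcompPro m n)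
  idCell A := D.vid (D.unit A)

/-- Composition of double functors. -/
def FunctorData.comp {D : DoubleCat.{v₁, u₁, w₁, z₁} D₀} {E : DoubleCat.{v₂, u₂, w₂, z₂} E₀}
    {K : DoubleCat.{v₃, u₃, w₃, z₃} K₀} (F : FunctorData D E) (G : FunctorData E K) :
    FunctorData D K where
  obj := F.obj ⋙ G.obj
  pro m := G.pro (F.pro m)
  cell α := G.cell (F.cell α)
  compCell m n := castCell (by simp) (by simp)
    (K.vcomp (G.compCell (F.pro m) (F.pro n)) (G.cell (F.compCell m n)))
  idCell A := castCell (by simp) (by simp)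
    (K.vcomp (G.idCell (F.obj.obj A)) (G.cell (F.idCell A)))

/-- A globular cell is invertible. -/
def InvertibleCell (D : DoubleCat.{v₁, u₁, w₁, z₁} D₀) {A B : D₀} {m n : D.Pro A B}
    (α : D.Cell m n (𝟙 A) (𝟙 B)) : Prop :=
  ∃ i : D.GlobIso m n, i.hom = α

/-- A (pseudo) double functor: functorial on arrows and on cells, with invertible, natural and
coherent comparison cells. -/
structure DoubleFunctor (D : DoubleCat.{v₁, u₁, w₁, z₁} D₀) (E : DoubleCat.{v₂, u₂, w₂, z₂} E₀)
    extends FunctorData D E where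
  cell_vid : ∀ {A B : D₀} (m : D.Pro A B), EqCell (cell (D.vid m)) (E.vid (pro m))
  cell_vcomp : ∀ {A B C G H K : D₀} {m : D.Pro A B} {n : D.Pro C G} {p : D.Pro H K}
    {f : A ⟶ C} {g : B ⟶ G} {f' : C ⟶ H} {g' : G ⟶ K}
    (α : D.Cell m n f g) (β : D.Cell n p f' g'),
    EqCell (cell (D.vcomp α β)) (E.vcomp (cell α) (cell β))
  compCell_invertible : ∀ {A B C : D₀} (m : D.Pro A B) (n : D.Pro B C),
    E.InvertibleCell (compCell m n)
  idCell_invertible : ∀ A : D₀, E.InvertibleCell (idCell A)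
  compCell_natural : ∀ {A B C A' B' C' : D₀} {m : D.Pro A B} {n : D.Pro B C}
    {m' : D.Pro A' B'} {n' : D.Pro B' C'} {f : A ⟶ A'} {g : B ⟶ B'} {h : C ⟶ C'}
    (α : D.Cell m m' f g) (β : D.Cell n n' g h),
    EqCell (E.vcomp (E.hcomp (cell α) (cell β)) (compCell m' n'))
      (E.vcomp (compCell m n) (cell (D.hcomp α β)))
  idCell_natural : ∀ {A B : D₀} (f : A ⟶ B),
    EqCell (E.vcomp (E.unitCell (obj.map f)) (idCell B))
      (E.vcomp (idCell A) (cell (D.unitCell f)))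
  assoc_coherence : ∀ {A B C G : D₀} (m : D.Pro A B) (n : D.Pro B C) (p : D.Pro C G),
    EqCell (E.vcomp (E.hcomp (compCell m n) (E.vid (pro p)))
        (E.vcomp (compCell (D.hcompPro m n) p) (cell (D.coh.assoc m n p).hom)))
      (E.vcomp (E.coh.assoc (pro m) (pro n) (pro p)).hom
        (E.vcomp (E.hcomp (E.vid (pro m)) (compCell n p)) (compCell m (D.hcompPro n p))))
  left_coherence : ∀ {A B : D₀} (m : D.Pro A B),
    EqCell (E.vcomp (E.hcomp (idCell A) (E.vid (pro m)))
        (E.vcomp (compCell (D.unit A) m) (cell (D.coh.leftUnitor m).hom)))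
      (E.coh.leftUnitor (pro m)).hom
  right_coherence : ∀ {A B : D₀} (m : D.Pro A B),
    EqCell (E.vcomp (E.hcomp (E.vid (pro m)) (idCell B))
        (E.vcomp (compCell m (D.unit B)) (cell (D.coh.rightUnitor m).hom)))
      (E.coh.rightUnitor (pro m)).hom

/-- A (vertical) transformation of double functors. -/
structure Transformation {D : DoubleCat.{v₁, u₁, w₁, z₁} D₀} {E : DoubleCat.{v₂, u₂, w₂, z₂} E₀}
    (F G : FunctorData D E) where
  app : F.obj ⟶ G.obj
  cell : ∀ {A B : D₀} (m : D.Pro A B), E.Cell (F.pro m) (G.pro m) (app.app A) (app.app B)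
  natural : ∀ {A B C H : D₀} {m : D.Pro A B} {n : D.Pro C H} {f : A ⟶ C} {g : B ⟶ H}
    (α : D.Cell m n f g), EqCell (E.vcomp (F.cell α) (cell n)) (E.vcomp (cell m) (G.cell α))
  hcomp_compat : ∀ {A B C : D₀} (m : D.Pro A B) (n : D.Pro B C),
    EqCell (E.vcomp (E.hcomp (cell m) (cell n)) (G.compCell m n))
      (E.vcomp (F.compCell m n) (cell (D.hcompPro m n)))
  unit_compat : ∀ A : D₀,
    EqCell (E.vcomp (E.unitCell (app.app A)) (G.idCell A))
      (E.vcomp (F.idCell A) (cell (D.unit A)))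

/-- An adjunction `F ⊣ G` in the 2-category of double categories, double functors and vertical
transformations: unit, counit and the two triangle identities. -/
structure DoubleAdjunction {D : DoubleCat.{v₁, u₁, w₁, z₁} D₀}
    {E : DoubleCat.{v₂, u₂, w₂, z₂} E₀} (F : DoubleFunctor D E) (G : DoubleFunctor E D) where
  unit : Transformation (FunctorData.id D) (F.toFunctorData.comp G.toFunctorData)
  counit : Transformation (G.toFunctorData.comp F.toFunctorData) (FunctorData.id E)
  left_triangle_obj : ∀ A : D₀,
    F.obj.map (unit.app.app A) ≫ counit.app.app (F.obj.obj A) = 𝟙 (F.obj.obj A)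
  left_triangle_pro : ∀ {A B : D₀} (m : D.Pro A B),
    EqCell (E.vcomp (F.cell (unit.cell m)) (counit.cell (F.pro m))) (E.vid (F.pro m))
  right_triangle_obj : ∀ A : E₀,
    unit.app.app (G.obj.obj A) ≫ G.obj.map (counit.app.app A) = 𝟙 (G.obj.obj A)
  right_triangle_pro : ∀ {A B : E₀} (m : E.Pro A B),
    EqCell (D.vcomp (unit.cell (G.pro m)) (G.cell (counit.cell m))) (D.vid (G.pro m))

/-- A double functor has a right adjoint in the 2-category of double categories. -/
def DoubleFunctor.HasRightAdjoint {D : DoubleCat.{v₁, u₁, w₁, z₁} D₀}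
    {E : DoubleCat.{v₂, u₂, w₂, z₂} E₀} (F : DoubleFunctor D E) : Prop :=
  ∃ G : DoubleFunctor E D, Nonempty (DoubleAdjunction F G)

end Functors

/-! ### Cartesian double categories -/

section Cartesian

/-- The operations of the product of two double categories, all componentwise. -/
def prodData {D₀ : Type u₁} [Category.{v₁} D₀] {E₀ : Type u₂} [Category.{v₂} E₀]
    (D : DoubleData.{v₁, u₁, w₁, z₁} D₀) (E : DoubleData.{v₂, u₂, w₂, z₂} E₀) :
    DoubleData (D₀ × E₀) where
  Pro A B := D.Pro A.1 B.1 × E.Pro A.2 B.2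
  Cell m n f g := D.Cell m.1 n.1 f.1 g.1 × E.Cell m.2 n.2 f.2 g.2
  vid m := (D.vid m.1, E.vid m.2)
  vcomp α β := (D.vcomp α.1 β.1, E.vcomp α.2 β.2)
  unit A := (D.unit A.1, E.unit A.2)
  unitCell f := (D.unitCell f.1, E.unitCell f.2)
  hcompPro m n := (D.hcompPro m.1 n.1, E.hcompPro m.2 n.2)
  hcomp α β := (D.hcomp α.1 β.1, E.hcomp α.2 β.2)

theorem eqCell_prod {D₀ : Type u₁} [Category.{v₁} D₀] {E₀ : Type u₂} [Category.{v₂} E₀]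
    {D : DoubleData.{v₁, u₁, w₁, z₁} D₀} {E : DoubleData.{v₂, u₂, w₂, z₂} E₀}
    {A B C G : D₀ × E₀} {m : (prodData D E).Pro A B} {n : (prodData D E).Pro C G}
    {f f' : A ⟶ C} {g g' : B ⟶ G}
    {α : (prodData D E).Cell m n f g} {β : (prodData D E).Cell m n f' g'}
    (h₁ : EqCell (X := D.toProSystem) (m := m.1) (n := n.1) (f := f.1) (g := g.1) (f' := f'.1)
      (g' := g'.1) α.1 β.1)
    (h₂ : EqCell (X := E.toProSystem) (m := m.2) (n := n.2) (f := f.2) (g := g.2) (f' := f'.2)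
      (g' := g'.2) α.2 β.2) : EqCell α β := by
  obtain ⟨f₁, f₂⟩ := f
  obtain ⟨f₁', f₂'⟩ := f'
  obtain ⟨g₁, g₂⟩ := g
  obtain ⟨g₁', g₂'⟩ := g'
  obtain ⟨α₁, α₂⟩ := α
  obtain ⟨β₁, β₂⟩ := β
  dsimp only at h₁ h₂
  cases h₁
  cases h₂
  rfl

/-- Componentwise invertible globular cells in a product. -/
def prodGlobIso {D₀ : Type u₁} [Category.{v₁} D₀] {E₀ : Type u₂} [Category.{v₂} E₀]
    {D : DoubleData.{v₁, u₁, w₁, z₁} D₀} {E : DoubleData.{v₂, u₂, w₂, z₂} E₀}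
    {A B : D₀ × E₀} {m n : (prodData D E).Pro A B}
    (i : D.GlobIso m.1 n.1) (j : E.GlobIso m.2 n.2) : (prodData D E).GlobIso m n where
  hom := (i.hom, j.hom)
  inv := (i.inv, j.inv)
  hom_inv := eqCell_prod i.hom_inv j.hom_inv
  inv_hom := eqCell_prod i.inv_hom j.inv_hom

/-- The product of two double categories. -/
def prod {D₀ : Type u₁} [Category.{v₁} D₀] {E₀ : Type u₂} [Category.{v₂} E₀]
    (D : DoubleCat.{v₁, u₁, w₁, z₁} D₀) (E : DoubleCat.{v₂, u₂, w₂, z₂} E₀) :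
    DoubleCat (D₀ × E₀) where
  toDoubleData := prodData D.toDoubleData E.toDoubleData
  coh :=
    { vid_vcomp := fun α => eqCell_prod (D.coh.vid_vcomp α.1) (E.coh.vid_vcomp α.2)
      vcomp_vid := fun α => eqCell_prod (D.coh.vcomp_vid α.1) (E.coh.vcomp_vid α.2)
      vassoc := fun α β γ => eqCell_prod (D.coh.vassoc α.1 β.1 γ.1) (E.coh.vassoc α.2 β.2 γ.2)
      unitCell_id := fun A => Prod.ext (D.coh.unitCell_id A.1) (E.coh.unitCell_id A.2)
      unitCell_comp := fun f g =>
        Prod.ext (D.coh.unitCell_comp f.1 g.1) (E.coh.unitCell_comp f.2 g.2)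
      hcomp_vid := fun m n => Prod.ext (D.coh.hcomp_vid m.1 n.1) (E.coh.hcomp_vid m.2 n.2)
      interchange := fun α β α' β' => Prod.ext (D.coh.interchange α.1 β.1 α'.1 β'.1)
        (E.coh.interchange α.2 β.2 α'.2 β'.2)
      assoc := fun m n p => prodGlobIso (D.coh.assoc m.1 n.1 p.1) (E.coh.assoc m.2 n.2 p.2)
      leftUnitor := fun m => prodGlobIso (D.coh.leftUnitor m.1) (E.coh.leftUnitor m.2)
      rightUnitor := fun m => prodGlobIso (D.coh.rightUnitor m.1) (E.coh.rightUnitor m.2)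
      assoc_natural := fun α β γ => eqCell_prod (D.coh.assoc_natural α.1 β.1 γ.1)
        (E.coh.assoc_natural α.2 β.2 γ.2)
      leftUnitor_natural := fun α =>
        eqCell_prod (D.coh.leftUnitor_natural α.1) (E.coh.leftUnitor_natural α.2)
      rightUnitor_natural := fun α =>
        eqCell_prod (D.coh.rightUnitor_natural α.1) (E.coh.rightUnitor_natural α.2)
      pentagon := fun m n p q => eqCell_prod (D.coh.pentagon m.1 n.1 p.1 q.1)
        (E.coh.pentagon m.2 n.2 p.2 q.2)
      triangle := fun m n => eqCell_prod (D.coh.triangle m.1 n.1) (E.coh.triangle m.2 n.2) }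

/-- The operations of the terminal double category. -/
def terminalData : DoubleData.{0, 0, 0, 0} (Discrete PUnit.{1}) where
  Pro _ _ := PUnit
  Cell _ _ _ _ := PUnit
  vid _ := ⟨⟩
  vcomp _ _ := ⟨⟩
  unit _ := ⟨⟩
  unitCell _ := ⟨⟩
  hcompPro _ _ := ⟨⟩
  hcomp _ _ := ⟨⟩

theorem eqCell_terminal {A B C G : Discrete PUnit.{1}} {m : terminalData.Pro A B}
    {n : terminalData.Pro C G} {f f' : A ⟶ C} {g g' : B ⟶ G}
    (α : terminalData.Cell m n f g) (β : terminalData.Cell m n f' g') : EqCell α β := by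
  cases Subsingleton.elim f f'
  cases Subsingleton.elim g g'
  rfl

/-- The terminal double category. -/
def terminal : DoubleCat.{0, 0, 0, 0} (Discrete PUnit.{1}) where
  toDoubleData := terminalData
  coh :=
    { vid_vcomp := fun _ => eqCell_terminal _ _
      vcomp_vid := fun _ => eqCell_terminal _ _
      vassoc := fun _ _ _ => eqCell_terminal _ _
      unitCell_id := fun _ => rfl
      unitCell_comp := fun _ _ => rfl
      hcomp_vid := fun _ _ => rfl
      interchange := fun _ _ _ _ => rfl
      assoc := fun _ _ _ => ⟨⟨⟩, ⟨⟩, eqCell_terminal _ _, eqCell_terminal _ _⟩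
      leftUnitor := fun _ => ⟨⟨⟩, ⟨⟩, eqCell_terminal _ _, eqCell_terminal _ _⟩
      rightUnitor := fun _ => ⟨⟨⟩, ⟨⟩, eqCell_terminal _ _, eqCell_terminal _ _⟩
      assoc_natural := fun _ _ _ => eqCell_terminal _ _
      leftUnitor_natural := fun _ => eqCell_terminal _ _
      rightUnitor_natural := fun _ => eqCell_terminal _ _
      pentagon := fun _ _ _ _ => eqCell_terminal _ _
      triangle := fun _ _ => eqCell_terminal _ _ }

section Diagonal

variable {D₀ : Type u} [Category.{v} D₀] (D : DoubleCat.{v, u, w, z} D₀)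

/-- The invertible globular cell `vid m`. -/
def vidIso {A B : D₀} (m : D.Pro A B) : D.GlobIso m m where
  hom := D.vid m
  inv := D.vid m
  hom_inv := D.coh.vid_vcomp _
  inv_hom := D.coh.vid_vcomp _

theorem eqCell_vid_swap {A B C G : D₀} {m : D.Pro A B} {n : D.Pro C G} {f : A ⟶ C} {g : B ⟶ G}
    (α : D.Cell m n f g) : EqCell (D.vcomp α (D.vid n)) (D.vcomp (D.vid m) α) :=
  (D.coh.vcomp_vid α).trans (D.coh.vid_vcomp α).symm

theorem eqCell_assoc_aux {A B C G : D₀} (m : D.Pro A B) (n : D.Pro B C) (p : D.Pro C G) :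
    EqCell (D.vcomp (D.hcomp (D.vid (D.hcompPro m n)) (D.vid p))
        (D.vcomp (D.vid (D.hcompPro (D.hcompPro m n) p)) (D.coh.assoc m n p).hom))
      (D.vcomp (D.coh.assoc m n p).hom
        (D.vcomp (D.hcomp (D.vid m) (D.vid (D.hcompPro n p)))
          (D.vid (D.hcompPro m (D.hcompPro n p))))) := by
  rw [D.coh.hcomp_vid, D.coh.hcomp_vid]
  have h₁ := D.coh.vid_vcomp (D.vcomp (D.vid (D.hcompPro (D.hcompPro m n) p))
    (D.coh.assoc m n p).hom)
  have h₂ := D.coh.vid_vcomp (D.coh.assoc m n p).hom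
  have h₃ := D.coh.vassoc (D.coh.assoc m n p).hom (D.vid (D.hcompPro m (D.hcompPro n p)))
    (D.vid (D.hcompPro m (D.hcompPro n p)))
  have h₄ := D.coh.vcomp_vid (D.vcomp (D.coh.assoc m n p).hom
    (D.vid (D.hcompPro m (D.hcompPro n p))))
  have h₅ := D.coh.vcomp_vid (D.coh.assoc m n p).hom
  exact h₁.trans (h₂.trans (h₅.symm.trans (h₄.symm.trans h₃)))

theorem eqCell_unitor_aux {A B C : D₀} (m : D.Pro A B) (n : D.Pro B C) {q : D.Pro A C}
    (α : D.Cell (D.hcompPro m n) q (𝟙 A) (𝟙 C)) :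
    EqCell (D.vcomp (D.hcomp (D.vid m) (D.vid n)) (D.vcomp (D.vid (D.hcompPro m n)) α)) α := by
  rw [D.coh.hcomp_vid]
  exact (D.coh.vid_vcomp _).trans (D.coh.vid_vcomp _)

/-- The diagonal double functor `D → D × D`. -/
def diagonal : DoubleFunctor D (D.prod D) where
  obj := Functor.diag D₀
  pro m := (m, m)
  cell α := (α, α)
  compCell m n := (D.vid (D.hcompPro m n), D.vid (D.hcompPro m n))
  idCell A := (D.vid (D.unit A), D.vid (D.unit A))
  cell_vid _ := rfl
  cell_vcomp _ _ := rfl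
  compCell_invertible _ _ := ⟨prodGlobIso (D.vidIso _) (D.vidIso _), rfl⟩
  idCell_invertible _ := ⟨prodGlobIso (D.vidIso _) (D.vidIso _), rfl⟩
  compCell_natural _ _ := eqCell_prod (D.eqCell_vid_swap _) (D.eqCell_vid_swap _)
  idCell_natural _ := eqCell_prod (D.eqCell_vid_swap _) (D.eqCell_vid_swap _)
  assoc_coherence m n p := eqCell_prod (D.eqCell_assoc_aux m n p) (D.eqCell_assoc_aux m n p)
  left_coherence _ := eqCell_prod (D.eqCell_unitor_aux _ _ _) (D.eqCell_unitor_aux _ _ _)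
  right_coherence _ := eqCell_prod (D.eqCell_unitor_aux _ _ _) (D.eqCell_unitor_aux _ _ _)

/-- The unique double functor `D → 1`. -/
def toTerminal : DoubleFunctor D terminal where
  obj := Functor.star D₀
  pro _ := ⟨⟩
  cell _ := ⟨⟩
  compCell _ _ := ⟨⟩
  idCell _ := ⟨⟩
  cell_vid _ := eqCell_terminal _ _
  cell_vcomp _ _ := eqCell_terminal _ _
  compCell_invertible _ _ := ⟨⟨⟨⟩, ⟨⟩, eqCell_terminal _ _, eqCell_terminal _ _⟩, rfl⟩
  idCell_invertible _ := ⟨⟨⟨⟩, ⟨⟩, eqCell_terminal _ _, eqCell_terminal _ _⟩, rfl⟩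
  compCell_natural _ _ := eqCell_terminal _ _
  idCell_natural _ := eqCell_terminal _ _
  assoc_coherence _ _ _ := eqCell_terminal _ _
  left_coherence _ := eqCell_terminal _ _
  right_coherence _ := eqCell_terminal _ _

/-- `D` is cartesian if `D → D × D` and `D → 1` have right adjoints in the 2-category of double
categories. -/
def IsCartesian : Prop := D.diagonal.HasRightAdjoint ∧ D.toTerminal.HasRightAdjoint

end Diagonal

end Cartesian

end DoubleCat

/-! ## Factorization systems and relations -/

section Relations

/-- An orthogonal factorization system. -/
structure OrthogonalFactorizationSystem (C : Type u) [Category.{v} C] where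
  E : MorphismProperty C
  M : MorphismProperty C
  E_of_isIso : ∀ {A B : C} (f : A ⟶ B), IsIso f → E f
  M_of_isIso : ∀ {A B : C} (f : A ⟶ B), IsIso f → M f
  E_comp : ∀ {A B X : C} (f : A ⟶ B) (g : B ⟶ X), E f → E g → E (f ≫ g)
  M_comp : ∀ {A B X : C} (f : A ⟶ B) (g : B ⟶ X), M f → M g → M (f ≫ g)
  fac : ∀ {A B : C} (f : A ⟶ B), ∃ (I : C) (e : A ⟶ I) (m : I ⟶ B), E e ∧ M m ∧ e ≫ m = f
  orth : ∀ {A B X Y : C} (e : A ⟶ X) (m : B ⟶ Y) (a : A ⟶ B) (b : X ⟶ Y), E e → M m →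
    e ≫ b = a ≫ m → ∃! d : X ⟶ B, e ≫ d = a ∧ d ≫ m = b

namespace OrthogonalFactorizationSystem

variable {C : Type u} [Category.{v} C] (F : OrthogonalFactorizationSystem C)

/-- `F` is stable if `E` is stable under pullback. -/
def IsStable : Prop := F.E.IsStableUnderBaseChange

/-- `F` is proper if `E`-arrows are epimorphisms and `M`-arrows are monomorphisms. -/
structure IsProper : Prop where
  epi : ∀ {A B : C} (f : A ⟶ B), F.E f → Epi f
  mono : ∀ {A B : C} (f : A ⟶ B), F.M f → Mono f

variable {F} in
/-- Split monomorphisms are in `M` if `E`-arrows are epimorphisms. In particular diagonals are. -/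
theorem M_of_retraction (hF : F.IsProper) {A B : C} (s : A ⟶ B) (r : B ⟶ A) (h : s ≫ r = 𝟙 A) :
    F.M s := by
  obtain ⟨I, e, m, he, hm, rfl⟩ := F.fac s
  have := hF.epi e he
  have h₁ : e ≫ m ≫ r = 𝟙 A := by simpa using h
  have h₂ : (m ≫ r) ≫ e = 𝟙 I := by
    rw [← cancel_epi e]
    simpa using congrArg (· ≫ e) h₁
  exact F.M_comp e m (F.M_of_isIso e ⟨m ≫ r, h₁, h₂⟩) hm

/-- The object through which the chosen factorization of `f` passes. -/
noncomputable def image {A B : C} (f : A ⟶ B) : C := (F.fac f).choose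

/-- The `E`-part of the chosen factorization of `f`. -/
noncomputable def imageE {A B : C} (f : A ⟶ B) : A ⟶ F.image f := (F.fac f).choose_spec.choose

/-- The `M`-part of the chosen factorization of `f`. -/
noncomputable def imageM {A B : C} (f : A ⟶ B) : F.image f ⟶ B :=
  (F.fac f).choose_spec.choose_spec.choose

theorem imageE_mem {A B : C} (f : A ⟶ B) : F.E (F.imageE f) :=
  (F.fac f).choose_spec.choose_spec.choose_spec.1

theorem imageM_mem {A B : C} (f : A ⟶ B) : F.M (F.imageM f) :=
  (F.fac f).choose_spec.choose_spec.choose_spec.2.1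

theorem image_fac {A B : C} (f : A ⟶ B) : F.imageE f ≫ F.imageM f = f :=
  (F.fac f).choose_spec.choose_spec.choose_spec.2.2

variable {F} in
/-- Images are functorial: a commutative square from `f` to `f'` induces an arrow of images. -/
theorem exists_imageMap {A B A' B' : C} {f : A ⟶ B} {f' : A' ⟶ B'} {a : A ⟶ A'} {b : B ⟶ B'}
    (h : f ≫ b = a ≫ f') :
    ∃! d : F.image f ⟶ F.image f',
      F.imageE f ≫ d = a ≫ F.imageE f' ∧ d ≫ F.imageM f' = F.imageM f ≫ b :=
  F.orth _ _ _ _ (F.imageE_mem f) (F.imageM_mem f') (by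
    rw [← Category.assoc, F.image_fac, h, Category.assoc, F.image_fac])

/-- The arrow of images induced by a commutative square. -/
noncomputable def imageMap {A B A' B' : C} {f : A ⟶ B} {f' : A' ⟶ B'} {a : A ⟶ A'} {b : B ⟶ B'}
    (h : f ≫ b = a ≫ f') : F.image f ⟶ F.image f' := (exists_imageMap h).choose

theorem imageMap_imageM {A B A' B' : C} {f : A ⟶ B} {f' : A' ⟶ B'} {a : A ⟶ A'} {b : B ⟶ B'}
    (h : f ≫ b = a ≫ f') : F.imageMap h ≫ F.imageM f' = F.imageM f ≫ b :=
  (exists_imageMap h).choose_spec.1.2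

variable [HasFiniteLimits C]

/-- An `F`-relation from `A` to `B`: a span whose legs are jointly in `M`. -/
structure Relation (A B : C) where
  apex : C
  l : apex ⟶ A
  r : apex ⟶ B
  mem : F.M (prod.lift l r)

variable {F}

/-- The span of a relation, as an arrow into the product. -/
noncomputable abbrev Relation.arrow {A B : C} (R : F.Relation A B) : R.apex ⟶ A ⨯ B :=
  prod.lift R.l R.r

/-- A cell of relations: a morphism of spans over `f` and `g`. -/
@[ext]
structure RelCell {A B A' B' : C} (R : F.Relation A B) (S : F.Relation A' B') (f : A ⟶ A')
    (g : B ⟶ B') where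
  hom : R.apex ⟶ S.apex
  hom_l : hom ≫ S.l = R.l ≫ f
  hom_r : hom ≫ S.r = R.r ≫ g

/-- The span `A ← R ×_B S → X`, as an arrow into the product. -/
noncomputable def pullbackSpan {A B X : C} (R : F.Relation A B) (S : F.Relation B X) :
    pullback R.r S.l ⟶ A ⨯ X :=
  prod.lift (pullback.fst R.r S.l ≫ R.l) (pullback.snd R.r S.l ≫ S.r)

/-- Composition of relations: the image of `R ×_B S → A × X`. -/
noncomputable def Relation.comp {A B X : C} (R : F.Relation A B) (S : F.Relation B X) :
    F.Relation A X where
  apex := F.image (pullbackSpan R S)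
  l := F.imageM (pullbackSpan R S) ≫ prod.fst
  r := F.imageM (pullbackSpan R S) ≫ prod.snd
  mem := by
    have h : prod.lift (F.imageM (pullbackSpan R S) ≫ prod.fst)
        (F.imageM (pullbackSpan R S) ≫ prod.snd) = F.imageM (pullbackSpan R S) := by
      apply Limits.prod.hom_ext
      · rw [prod.lift_fst]
      · rw [prod.lift_snd]
    rw [h]
    exact F.imageM_mem _

/-- The arrow `R ×_B S ⟶ R' ×_{B'} S'` induced by two cells. -/
noncomputable def RelCell.pullbackMap {A B X A' B' X' : C} {R : F.Relation A B}
    {S : F.Relation B X} {R' : F.Relation A' B'} {S' : F.Relation B' X'} {f : A ⟶ A'}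
    {g : B ⟶ B'} {h : X ⟶ X'} (α : RelCell R R' f g) (β : RelCell S S' g h) :
    pullback R.r S.l ⟶ pullback R'.r S'.l :=
  pullback.lift (pullback.fst R.r S.l ≫ α.hom) (pullback.snd R.r S.l ≫ β.hom) (by
    simp only [Category.assoc, α.hom_r, β.hom_l]
    rw [pullback.condition_assoc])

theorem RelCell.pullbackMap_comm {A B X A' B' X' : C} {R : F.Relation A B}
    {S : F.Relation B X} {R' : F.Relation A' B'} {S' : F.Relation B' X'} {f : A ⟶ A'}
    {g : B ⟶ B'} {h : X ⟶ X'} (α : RelCell R R' f g) (β : RelCell S S' g h) :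
    pullbackSpan R S ≫ prod.map f h = α.pullbackMap β ≫ pullbackSpan R' S' := by
  simp only [pullbackSpan, RelCell.pullbackMap, prod.lift_map, prod.comp_lift, Category.assoc,
    pullback.lift_fst_assoc, pullback.lift_snd_assoc, α.hom_l, β.hom_r]

/-- External composition of cells, by functoriality of pullbacks and of images. -/
noncomputable def RelCell.hcomp {A B X A' B' X' : C} {R : F.Relation A B}
    {S : F.Relation B X} {R' : F.Relation A' B'} {S' : F.Relation B' X'} {f : A ⟶ A'}
    {g : B ⟶ B'} {h : X ⟶ X'} (α : RelCell R R' f g) (β : RelCell S S' g h) :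
    RelCell (R.comp S) (R'.comp S') f h where
  hom := F.imageMap (α.pullbackMap_comm β)
  hom_l := by
    simp only [Relation.comp]
    rw [← Category.assoc, F.imageMap_imageM]
    simp
  hom_r := by
    simp only [Relation.comp]
    rw [← Category.assoc, F.imageMap_imageM]
    simp

variable (F) in
/-- The operations of the double category `Rel(C; F)` of `F`-relations. The external unit on `A` is
the span `A ← A → A` of identities. -/
noncomputable def rel (hF : F.IsProper) : DoubleData.{v, u, max u v, v} C where
  Pro A B := F.Relation A B
  Cell R S f g := RelCell R S f g
  vid R := ⟨𝟙 R.apex, by simp, by simp⟩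
  vcomp α β := ⟨α.hom ≫ β.hom,
    by rw [Category.assoc, β.hom_l, ← Category.assoc, α.hom_l, Category.assoc],
    by rw [Category.assoc, β.hom_r, ← Category.assoc, α.hom_r, Category.assoc]⟩
  unit A := ⟨A, 𝟙 A, 𝟙 A, M_of_retraction hF _ prod.fst (prod.lift_fst _ _)⟩
  unitCell f := ⟨f, by simp, by simp⟩
  hcompPro R S := R.comp S
  hcomp α β := α.hcomp β

end OrthogonalFactorizationSystem

end Relations

/-! ## Thin double categories -/

/-! Since `M`-arrows are monic, a morphism of spans into an `F`-relation is determined by its sides.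
So `Rel(C; F)` is thin, and every equation between cells, coherence laws included, reduces to an
equation between arrows of `C`. What remains is to construct cells.

This is done with generalized elements: a relation is known by the pairs `(x, y)` that factor
through it (`Relation.Mem`), and a cell is the same as an implication between memberships
(`RelCell.mem`, `RelCell.ofMem`). Orthogonality makes membership local: it may be checked after an
`E`-arrow (`Mem.of_cover`). Stability gives composition its usual meaning: `(x, z)` lies in a
composite iff, after some `E`-arrow, there is an intermediate `y` (`mem_comp_iff`). The structure of
the double category, its local products and its cartesian structure thereby become computations in
the internal logic of `∃` and `∧`, where "there exists" means "exists on an `E`-cover".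

The tabulator of a relation is its apex, because a cell from `y_A` to `R` is an arrow from `A` to
the apex. Any other tabulator is isomorphic to it, so its legs are jointly in `M`, and every element
of `m` is the image under the legs of an element `d` of the tabulator. That `d` is an intermediate
element showing that `l^* ⊗ r_!` contains `m`. Elements of the kernel `f_! ⊗ f^*` are identified by
`f`, hence joint monicity of the legs makes the intersection of their kernels the identity relation.
-/

/-- A system of proarrows and cells is thin if a cell is determined by its boundary. -/
def ProSystem.IsThin {D₀ : Type u} [Category.{v} D₀] (X : ProSystem.{v, u, w, z} D₀) : Prop :=
  ∀ ⦃A B C D : D₀⦄ ⦃m : X.Pro A B⦄ ⦃n : X.Pro C D⦄ ⦃f : A ⟶ C⦄ ⦃g : B ⟶ D⦄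
    (α β : X.Cell m n f g), α = β

/-- This disposes of every coherence law below: only the sides have to be compared. -/
theorem ProSystem.IsThin.eqCell {D₀ : Type u} [Category.{v} D₀] {X : ProSystem.{v, u, w, z} D₀}
    (hX : X.IsThin) {A B C D : D₀} {m : X.Pro A B} {n : X.Pro C D} {f f' : A ⟶ C} {g g' : B ⟶ D}
    {α : X.Cell m n f g} {β : X.Cell m n f' g'} (hf : f = f') (hg : g = g') : EqCell α β := by
  subst hf hg
  rw [hX α β]
  rfl

namespace DoubleCat

variable {D₀ : Type u} [Category.{v} D₀] {D : DoubleCat.{v, u, w, z} D₀}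

theorem hor_hom_eq (hD : D.IsThin) {A B : D₀} {m n : D.Hor A B} (s t : m ⟶ n) : s = t :=
  Subtype.ext (hD.eqCell (s.2.1.trans t.2.1.symm) (s.2.2.trans t.2.2.symm))

/-- In a thin double category `D(A, B)` is a preorder, so any cell backwards is an inverse. -/
theorem hor_isIso (hD : D.IsThin) {A B : D₀} {m n : D.Hor A B} (s : m ⟶ n) (t : n ⟶ m) :
    IsIso s :=
  ⟨t, hor_hom_eq hD _ _, hor_hom_eq hD _ _⟩

theorem prod_isThin (hD : D.IsThin) : (D.prod D).IsThin :=
  fun _ _ _ _ _ _ _ _ α β => Prod.ext (hD α.1 β.1) (hD α.2 β.2)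

end DoubleCat

/-! ## Generalized elements of relations -/

namespace OrthogonalFactorizationSystem

variable {C : Type u} [Category.{v} C] {F : OrthogonalFactorizationSystem C}

/-- An arrow is in `M` if it has the right lifting property against `E`. -/
theorem M_of_lift (hP : F.IsProper) {A B : C} (f : A ⟶ B)
    (h : ∀ {X Y : C} (e : X ⟶ Y) (a : X ⟶ A) (b : Y ⟶ B), F.E e → e ≫ b = a ≫ f →
      ∃ d : Y ⟶ A, e ≫ d = a ∧ d ≫ f = b) : F.M f := by
  obtain ⟨I, e, m, he, hm, rfl⟩ := F.fac f
  -- Lifting the `E`-part of `f` against `f` itself gives a retraction of `e`; an epimorphism with a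
  -- retraction is invertible.
  obtain ⟨d, hd, -⟩ := h e (𝟙 A) m he (by simp)
  have := hP.epi e he
  have hd' : d ≫ e = 𝟙 I := by
    rw [← cancel_epi e, ← Category.assoc, hd, Category.id_comp, Category.comp_id]
  exact F.M_comp e m (F.M_of_isIso e ⟨d, hd, hd'⟩) hm

variable [HasFiniteLimits C]

attribute [local simp] prod.lift_fst prod.lift_snd prod.lift_fst_assoc prod.lift_snd_assoc
  pullback.lift_fst pullback.lift_snd pullback.lift_fst_assoc pullback.lift_snd_assoc

/-- The legs of a span are jointly in `M` if they are jointly monic and pairs of arrows that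
factor through the span after an `E`-arrow do so. -/
theorem M_prod_lift (hP : F.IsProper) {R A B : C} (l : R ⟶ A) (r : R ⟶ B)
    (hmono : ∀ {X : C} (d d' : X ⟶ R), d ≫ l = d' ≫ l → d ≫ r = d' ≫ r → d = d')
    (h : ∀ {X Y : C} (e : X ⟶ Y) (t : X ⟶ R) (x : Y ⟶ A) (y : Y ⟶ B), F.E e →
      t ≫ l = e ≫ x → t ≫ r = e ≫ y → ∃ d : Y ⟶ R, d ≫ l = x ∧ d ≫ r = y) :
    F.M (prod.lift l r) := by
  refine M_of_lift hP _ fun e a b he hab => ?_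
  have h₁ : a ≫ l = e ≫ b ≫ prod.fst := by
    simpa using (congrArg (· ≫ prod.fst) hab).symm
  have h₂ : a ≫ r = e ≫ b ≫ prod.snd := by
    simpa using (congrArg (· ≫ prod.snd) hab).symm
  obtain ⟨d, hd₁, hd₂⟩ := h e a _ _ he h₁ h₂
  -- The upper triangle comes from joint monicity: `e ≫ d` and `a` agree after both legs.
  refine ⟨d, hmono _ _ (by simp [hd₁, h₁]) (by simp [hd₂, h₂]), ?_⟩
  apply Limits.prod.hom_ext <;> simp [hd₁, hd₂]

namespace Relation

variable {A B X Y : C}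

/-- The pair of generalized elements `(x, y)` belongs to the relation `R`. -/
def Mem (R : F.Relation A B) (x : X ⟶ A) (y : X ⟶ B) : Prop :=
  ∃ d : X ⟶ R.apex, d ≫ R.l = x ∧ d ≫ R.r = y

theorem mem_legs (R : F.Relation A B) : R.Mem R.l R.r := ⟨𝟙 _, by simp, by simp⟩

theorem Mem.precomp {R : F.Relation A B} {x : X ⟶ A} {y : X ⟶ B} (h : R.Mem x y) (t : Y ⟶ X) :
    R.Mem (t ≫ x) (t ≫ y) := by
  obtain ⟨d, rfl, rfl⟩ := h
  exact ⟨t ≫ d, by simp, by simp⟩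

theorem hom_ext (hP : F.IsProper) (R : F.Relation A B) {d d' : X ⟶ R.apex}
    (hl : d ≫ R.l = d' ≫ R.l) (hr : d ≫ R.r = d' ≫ R.r) : d = d' := by
  have := hP.mono _ R.mem
  rw [← cancel_mono R.arrow]
  apply Limits.prod.hom_ext <;> simpa

/-- Membership in a relation is local with respect to `E`-arrows. -/
theorem Mem.of_cover {R : F.Relation A B} {x : X ⟶ A} {y : X ⟶ B} {e : Y ⟶ X} (he : F.E e)
    (h : R.Mem (e ≫ x) (e ≫ y)) : R.Mem x y := by
  obtain ⟨t, hl, hr⟩ := h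
  obtain ⟨d, ⟨-, hd⟩, -⟩ := F.orth e R.arrow t (prod.lift x y) he R.mem
    (by apply Limits.prod.hom_ext <;> simp [hl, hr])
  exact ⟨d, by simpa using congrArg (· ≫ prod.fst) hd, by simpa using congrArg (· ≫ prod.snd) hd⟩

/-- The `E`-arrow from the pullback of two relations to their composite. -/
noncomputable def compE {Z : C} (R : F.Relation A B) (S : F.Relation B Z) :
    pullback R.r S.l ⟶ (R.comp S).apex := F.imageE (pullbackSpan R S)

theorem compE_mem {Z : C} (R : F.Relation A B) (S : F.Relation B Z) : F.E (R.compE S) :=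
  F.imageE_mem _

theorem compE_l {Z : C} (R : F.Relation A B) (S : F.Relation B Z) :
    R.compE S ≫ (R.comp S).l = pullback.fst R.r S.l ≫ R.l := by
  have h : (F.imageE (pullbackSpan R S) ≫ F.imageM (pullbackSpan R S)) ≫ prod.fst =
      pullback.fst R.r S.l ≫ R.l := by
    rw [F.image_fac]; simp [pullbackSpan]
  exact (Category.assoc _ _ _).symm.trans h

theorem compE_r {Z : C} (R : F.Relation A B) (S : F.Relation B Z) :
    R.compE S ≫ (R.comp S).r = pullback.snd R.r S.l ≫ S.r := by
  have h : (F.imageE (pullbackSpan R S) ≫ F.imageM (pullbackSpan R S)) ≫ prod.snd =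
      pullback.snd R.r S.l ≫ S.r := by
    rw [F.image_fac]; simp [pullbackSpan]
  exact (Category.assoc _ _ _).symm.trans h

/-- The half of `mem_comp_iff` that needs neither a cover nor stability: the two witnesses pair to
an arrow into the pullback. -/
theorem mem_comp_of_mem {Z : C} {R : F.Relation A B} {S : F.Relation B Z} {x : X ⟶ A} {y : X ⟶ B}
    {z : X ⟶ Z} (h : R.Mem x y) (h' : S.Mem y z) : (R.comp S).Mem x z := by
  obtain ⟨d, rfl, rfl⟩ := h
  obtain ⟨d', hd', rfl⟩ := h'
  exact ⟨pullback.lift d d' hd'.symm ≫ R.compE S, by simp [compE_l], by simp [compE_r]⟩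

/-- A pair belongs to a composite iff there is an intermediate element after some `E`-arrow. -/
theorem mem_comp_iff (hS : F.IsStable) {Z : C} {R : F.Relation A B} {S : F.Relation B Z}
    {x : X ⟶ A} {z : X ⟶ Z} :
    (R.comp S).Mem x z ↔
      ∃ (Y : C) (e : Y ⟶ X) (y : Y ⟶ B), F.E e ∧ R.Mem (e ≫ x) y ∧ S.Mem y (e ≫ z) := by
  refine ⟨?_, fun ⟨Y, e, y, he, h, h'⟩ => (mem_comp_of_mem h h').of_cover he⟩
  rintro ⟨d, rfl, rfl⟩
  have : F.E.IsStableUnderBaseChange := hS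
  -- The required cover is the pullback of `q` along `d`, in `E` by stability. Its other projection
  -- lands in `R ×_B S`, where the intermediate element is visible.
  let q := R.compE S
  have hw : pullback.fst d q ≫ d = pullback.snd d q ≫ q := pullback.condition
  have hl := (reassoc_of% hw) (R.comp S).l
  have hr := (reassoc_of% hw) (R.comp S).r
  rw [compE_l] at hl
  rw [compE_r] at hr
  refine ⟨_, pullback.fst d q, pullback.snd d q ≫ pullback.fst R.r S.l ≫ R.r,
    MorphismProperty.pullback_fst _ _ (compE_mem R S), ?_, ?_⟩
  · exact ⟨pullback.snd d q ≫ pullback.fst R.r S.l, by simp [hl], by simp⟩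
  · refine ⟨pullback.snd d q ≫ pullback.snd R.r S.l, ?_, by simp [hr]⟩
    rw [Category.assoc, ← pullback.condition]

end Relation

/-! ### Cells as inclusions of relations -/

theorem RelCell.mem {A B A' B' X : C} {R : F.Relation A B} {S : F.Relation A' B'} {f : A ⟶ A'}
    {g : B ⟶ B'} (α : RelCell R S f g) {x : X ⟶ A} {y : X ⟶ B} (h : R.Mem x y) :
    S.Mem (x ≫ f) (y ≫ g) := by
  obtain ⟨d, rfl, rfl⟩ := h
  exact ⟨d ≫ α.hom, by simp [α.hom_l], by simp [α.hom_r]⟩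

/-- The cell that expresses that `R` is contained in the inverse image of `S`. -/
noncomputable def RelCell.ofMem {A B A' B' : C} {R : F.Relation A B} {S : F.Relation A' B'}
    {f : A ⟶ A'} {g : B ⟶ B'}
    (h : ∀ {X : C} (x : X ⟶ A) (y : X ⟶ B), R.Mem x y → S.Mem (x ≫ f) (y ≫ g)) :
    RelCell R S f g where
  -- Yoneda: the hypothesis is applied to the generic element, the pair of legs of `R`.
  hom := (h _ _ R.mem_legs).choose
  hom_l := (h _ _ R.mem_legs).choose_spec.1
  hom_r := (h _ _ R.mem_legs).choose_spec.2

/-- Both morphisms of spans have the same composites with the legs of `S`, which are jointly monic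
because `F` is proper. -/
theorem rel_isThin (hP : F.IsProper) : (F.rel hP).IsThin := by
  intro A B A' B' R S f g α β
  exact RelCell.ext (S.hom_ext hP (α.hom_l.trans β.hom_l.symm) (α.hom_r.trans β.hom_r.symm))

theorem mem_unit_iff (hP : F.IsProper) {A X : C} {x y : X ⟶ A} :
    Relation.Mem (F := F) ((F.rel hP).unit A) x y ↔ x = y := by
  refine ⟨?_, ?_⟩
  · rintro ⟨d, rfl, rfl⟩; rfl
  · rintro rfl; exact ⟨x, Category.comp_id _, Category.comp_id _⟩

/-- Relations with the same elements are isomorphic. -/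
noncomputable def relGlobIso (hP : F.IsProper) {A B : C} {R S : F.Relation A B}
    (h : ∀ {X : C} (x : X ⟶ A) (y : X ⟶ B), R.Mem x y ↔ S.Mem x y) : (F.rel hP).GlobIso R S where
  hom := RelCell.ofMem fun x y hxy => by simpa using (h x y).1 hxy
  inv := RelCell.ofMem fun x y hxy => by simpa using (h x y).2 hxy
  hom_inv := (rel_isThin hP).eqCell (by simp) (by simp)
  inv_hom := (rel_isThin hP).eqCell (by simp) (by simp)

/-- Both sides ask for two intermediate elements on a cover. The second one appears on a finer
cover, to which the first is restricted; covers compose. -/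
theorem Relation.mem_comp_assoc (hS : F.IsStable) {A B Z W X : C} (R : F.Relation A B)
    (S : F.Relation B Z) (T : F.Relation Z W) (x : X ⟶ A) (y : X ⟶ W) :
    ((R.comp S).comp T).Mem x y ↔ (R.comp (S.comp T)).Mem x y := by
  constructor
  · intro h
    obtain ⟨Y, e, z, he, h₁, h₂⟩ := (mem_comp_iff hS).1 h
    obtain ⟨Y', e', w, he', h₃, h₄⟩ := (mem_comp_iff hS).1 h₁
    refine (mem_comp_iff hS).2 ⟨Y', e' ≫ e, w, F.E_comp _ _ he' he, by simpa using h₃, ?_⟩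
    exact mem_comp_of_mem h₄ (by simpa using h₂.precomp e')
  · intro h
    obtain ⟨Y, e, z, he, h₁, h₂⟩ := (mem_comp_iff hS).1 h
    obtain ⟨Y', e', w, he', h₃, h₄⟩ := (mem_comp_iff hS).1 h₂
    refine (mem_comp_iff hS).2 ⟨Y', e' ≫ e, w, F.E_comp _ _ he' he, ?_, by simpa using h₄⟩
    exact mem_comp_of_mem (by simpa using h₁.precomp e') h₃

/-- The unit forces the intermediate element to be the restriction of `x` to the cover, and locality
then removes the cover. -/
theorem mem_unit_comp_iff (hS : F.IsStable) (hP : F.IsProper) {A B X : C} (R : F.Relation A B)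
    (x : X ⟶ A) (y : X ⟶ B) :
    (Relation.comp (F := F) ((F.rel hP).unit A) R).Mem x y ↔ R.Mem x y := by
  refine ⟨fun h => ?_, fun h => Relation.mem_comp_of_mem ((mem_unit_iff hP).2 rfl) h⟩
  obtain ⟨Y, e, z, he, h₁, h₂⟩ := (Relation.mem_comp_iff hS).1 h
  obtain rfl := (mem_unit_iff hP).1 h₁
  exact h₂.of_cover he

theorem mem_comp_unit_iff (hS : F.IsStable) (hP : F.IsProper) {A B X : C} (R : F.Relation A B)
    (x : X ⟶ A) (y : X ⟶ B) :
    (R.comp ((F.rel hP).unit B)).Mem x y ↔ R.Mem x y := by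
  refine ⟨fun h => ?_, fun h => Relation.mem_comp_of_mem h ((mem_unit_iff hP).2 rfl)⟩
  obtain ⟨Y, e, z, he, h₁, h₂⟩ := (Relation.mem_comp_iff hS).1 h
  obtain rfl := (mem_unit_iff hP).1 h₂
  exact h₁.of_cover he

/-! ## The double category of relations -/

/-- The double category of `F`-relations. -/
noncomputable def relDoubleCat (hS : F.IsStable) (hP : F.IsProper) :
    DoubleCat.{v, u, max u v, v} C where
  toDoubleData := F.rel hP
  coh :=
    { vid_vcomp := fun _ => (rel_isThin hP).eqCell (by simp) (by simp)
      vcomp_vid := fun _ => (rel_isThin hP).eqCell (by simp) (by simp)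
      vassoc := fun _ _ _ => (rel_isThin hP).eqCell (by simp) (by simp)
      unitCell_id := fun _ => rel_isThin hP _ _
      unitCell_comp := fun _ _ => rel_isThin hP _ _
      hcomp_vid := fun _ _ => rel_isThin hP _ _
      interchange := fun _ _ _ _ => rel_isThin hP _ _
      assoc := fun R S T => relGlobIso hP (Relation.mem_comp_assoc hS R S T)
      leftUnitor := fun R => relGlobIso hP (mem_unit_comp_iff hS hP R)
      rightUnitor := fun R => relGlobIso hP (mem_comp_unit_iff hS hP R)
      assoc_natural := fun _ _ _ => (rel_isThin hP).eqCell (by simp) (by simp)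
      leftUnitor_natural := fun _ => (rel_isThin hP).eqCell (by simp) (by simp)
      rightUnitor_natural := fun _ => (rel_isThin hP).eqCell (by simp) (by simp)
      pentagon := fun _ _ _ _ => (rel_isThin hP).eqCell (by simp) (by simp)
      triangle := fun _ _ => (rel_isThin hP).eqCell (by simp) (by simp) }

variable (hS : F.IsStable) (hP : F.IsProper)

/-! ### Unit-purity, companions and conjoints -/

theorem relDoubleCat_isThin : (relDoubleCat hS hP).IsThin := rel_isThin hP

/-- The legs of a unit relation are identities, so the underlying arrow of a cell between units
equals both of its sides. -/
theorem relDoubleCat_isUnitPure : (relDoubleCat hS hP).IsUnitPure where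
  map_surjective := by
    rintro A B ⟨f, g, α⟩
    obtain ⟨h, hl, hr⟩ := α
    have hl' : h = f := (Category.comp_id h).symm.trans (hl.trans (Category.id_comp f))
    have hr' : h = g := (Category.comp_id h).symm.trans (hr.trans (Category.id_comp g))
    exact ⟨h, (relDoubleCat_isThin hS hP).eqCell hl' hr'⟩

/-- The companion is the graph of `f`, the conjoint the reversed graph. Each is split by a
projection, hence in `M`. The binding cells are `𝟙 A` and `f` on apexes. -/
theorem relDoubleCat_isEquipment : (relDoubleCat hS hP).IsEquipment := by
  intro A B f
  refine ⟨⟨?_⟩, ⟨?_⟩⟩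
  · exact
      { pro := (⟨A, 𝟙 A, f, M_of_retraction hP _ prod.fst (prod.lift_fst _ _)⟩ : F.Relation A B)
        η := (⟨𝟙 A, rfl, rfl⟩ : RelCell _ _ _ _)
        ε := (⟨f, (Category.comp_id f).trans (Category.id_comp f).symm, rfl⟩ : RelCell _ _ _ _)
        hcomp_eq := (rel_isThin hP).eqCell (by simp) (by simp)
        vcomp_eq := (rel_isThin hP).eqCell (by simp) (by simp) }
  · exact
      { pro := (⟨A, f, 𝟙 A, M_of_retraction hP _ prod.snd (prod.lift_snd _ _)⟩ : F.Relation B A)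
        η := (⟨𝟙 A, rfl, rfl⟩ : RelCell _ _ _ _)
        ε := (⟨f, rfl, (Category.comp_id f).trans (Category.id_comp f).symm⟩ : RelCell _ _ _ _)
        hcomp_eq := (rel_isThin hP).eqCell (by simp) (by simp)
        vcomp_eq := (rel_isThin hP).eqCell (by simp) (by simp) }

/-! ### Local products -/

namespace Relation

variable {A B X : C}

/-- The largest relation. -/
noncomputable def top (hP : F.IsProper) (A B : C) : F.Relation A B where
  apex := A ⨯ B
  l := prod.fst
  r := prod.snd
  mem := M_of_retraction hP _ (𝟙 _) (by
    apply Limits.prod.hom_ext <;> simp)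

theorem mem_top (x : X ⟶ A) (y : X ⟶ B) : (top hP A B).Mem x y :=
  ⟨prod.lift x y, prod.lift_fst _ _, prod.lift_snd _ _⟩

/-- The intersection is the pullback of the two subobjects of `A × B`. Its span is in `M` because
membership in both relations is local. -/
theorem exists_mem_inf_iff (hP : F.IsProper) (R S : F.Relation A B) :
    ∃ T : F.Relation A B, ∀ {X : C} (x : X ⟶ A) (y : X ⟶ B),
      T.Mem x y ↔ R.Mem x y ∧ S.Mem x y := by
  have hf : pullback.fst R.arrow S.arrow ≫ R.l = pullback.snd R.arrow S.arrow ≫ S.l := by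
    simpa using congrArg (· ≫ prod.fst) (pullback.condition (f := R.arrow) (g := S.arrow))
  have hs : pullback.fst R.arrow S.arrow ≫ R.r = pullback.snd R.arrow S.arrow ≫ S.r := by
    simpa using congrArg (· ≫ prod.snd) (pullback.condition (f := R.arrow) (g := S.arrow))
  have key : ∀ {X : C} (x : X ⟶ A) (y : X ⟶ B), R.Mem x y → S.Mem x y →
      ∃ d : X ⟶ pullback R.arrow S.arrow,
        d ≫ pullback.fst R.arrow S.arrow ≫ R.l = x ∧
        d ≫ pullback.fst R.arrow S.arrow ≫ R.r = y := by
    rintro X _ _ ⟨d, rfl, rfl⟩ ⟨d', hl, hr⟩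
    have hd : d ≫ R.arrow = d' ≫ S.arrow := by
      apply Limits.prod.hom_ext <;> simp [hl, hr]
    exact ⟨pullback.lift d d' hd, by simp, by simp⟩
  refine ⟨⟨pullback R.arrow S.arrow, pullback.fst R.arrow S.arrow ≫ R.l,
    pullback.fst R.arrow S.arrow ≫ R.r, M_prod_lift hP _ _ ?_ ?_⟩, fun x y => ⟨?_, ?_⟩⟩
  · intro X d d' hl hr
    apply pullback.hom_ext
    · exact R.hom_ext hP (by simpa using hl) (by simpa using hr)
    · exact S.hom_ext hP (by simpa [hf] using hl) (by simpa [hs] using hr)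
  -- On the cover, `t` witnesses membership in both relations; each membership descends separately,
  -- and `key` recombines them.
  · intro X Y e t x y he hl hr
    refine key x y (Mem.of_cover he ⟨t ≫ pullback.fst _ _, ?_, ?_⟩)
      (Mem.of_cover he ⟨t ≫ pullback.snd _ _, ?_, ?_⟩)
    · simpa using hl
    · simpa using hr
    · simpa [hf] using hl
    · simpa [hs] using hr
  · rintro ⟨d, rfl, rfl⟩
    exact ⟨⟨d ≫ pullback.fst _ _, by simp, by simp⟩,
      ⟨d ≫ pullback.snd _ _, by simp [hf], by simp [hs]⟩⟩
  · rintro ⟨h₁, h₂⟩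
    exact key x y h₁ h₂

end Relation

/-- The globular cell given by an inclusion of relations. -/
noncomputable def horHom {A B : C} {R S : (relDoubleCat hS hP).Hor A B}
    (h : ∀ {X : C} (x : X ⟶ A) (y : X ⟶ B), Relation.Mem (F := F) R.pro x y →
      Relation.Mem (F := F) S.pro x y) : R ⟶ S :=
  ⟨⟨𝟙 A, 𝟙 B, RelCell.ofMem fun x y hxy => by simpa using h x y hxy⟩, rfl, rfl⟩

theorem mem_of_horHom {A B X : C} {R S : (relDoubleCat hS hP).Hor A B} (s : R ⟶ S) {x : X ⟶ A}
    {y : X ⟶ B} (h : Relation.Mem (F := F) R.pro x y) : Relation.Mem (F := F) S.pro x y := by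
  obtain ⟨⟨f, g, α⟩, hf, hg⟩ := s
  dsimp only at hf hg
  subst hf hg
  simpa using RelCell.mem α h

/-- In a preorder, products are meets: the largest relation and intersections suffice. -/
theorem relDoubleCat_hasLocalProducts : (relDoubleCat hS hP).HasLocalProducts := by
  intro A B
  have hD := relDoubleCat_isThin hS hP
  have : HasTerminal ((relDoubleCat hS hP).Hor A B) :=
    (IsTerminal.ofUniqueHom (Y := (⟨Relation.top hP A B⟩ : (relDoubleCat hS hP).Hor A B))
      (fun _ => horHom hS hP fun x y _ => Relation.mem_top hP x y)
      fun _ _ => DoubleCat.hor_hom_eq hD _ _).hasTerminal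
  have : HasBinaryProducts ((relDoubleCat hS hP).Hor A B) := by
    refine @hasBinaryProducts_of_hasLimit_pair _ _ @fun R S => ?_
    obtain ⟨T, hT⟩ := Relation.exists_mem_inf_iff hP (A := A) (B := B) R.pro S.pro
    let T' : (relDoubleCat hS hP).Hor A B := ⟨T⟩
    let p : T' ⟶ R := horHom hS hP fun x y h => ((hT x y).1 h).1
    let q : T' ⟶ S := horHom hS hP fun x y h => ((hT x y).1 h).2
    exact ⟨⟨BinaryFan.mk p q, BinaryFan.isLimitMk
      (fun s => horHom hS hP fun x y h =>
        (hT x y).2 ⟨mem_of_horHom hS hP s.fst h, mem_of_horHom hS hP s.snd h⟩)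
      (fun _ => DoubleCat.hor_hom_eq hD _ _) (fun _ => DoubleCat.hor_hom_eq hD _ _)
      (fun _ _ _ _ => DoubleCat.hor_hom_eq hD _ _)⟩⟩
  exact hasFiniteProducts_of_has_binary_and_terminal

/-! ### Cartesian structure -/

theorem Relation.M_prod_map (hP : F.IsProper) {A B A' B' : C} (R : F.Relation A B)
    (S : F.Relation A' B') : F.M (prod.lift (prod.map R.l S.l) (prod.map R.r S.r)) := by
  refine M_prod_lift hP _ _ ?_ ?_
  · intro X d d' hl hr
    apply Limits.prod.hom_ext
    · exact R.hom_ext hP (by simpa using congrArg (· ≫ prod.fst) hl)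
        (by simpa using congrArg (· ≫ prod.fst) hr)
    · exact S.hom_ext hP (by simpa using congrArg (· ≫ prod.snd) hl)
        (by simpa using congrArg (· ≫ prod.snd) hr)
  · intro X Y e t x y he hl hr
    obtain ⟨d, hd₁, hd₂⟩ : R.Mem (x ≫ prod.fst) (y ≫ prod.fst) :=
      Mem.of_cover he ⟨t ≫ prod.fst, by simpa using congrArg (· ≫ prod.fst) hl,
        by simpa using congrArg (· ≫ prod.fst) hr⟩
    obtain ⟨d', hd₁', hd₂'⟩ : S.Mem (x ≫ prod.snd) (y ≫ prod.snd) :=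
      Mem.of_cover he ⟨t ≫ prod.snd, by simpa using congrArg (· ≫ prod.snd) hl,
        by simpa using congrArg (· ≫ prod.snd) hr⟩
    refine ⟨prod.lift d d', ?_, ?_⟩ <;> apply Limits.prod.hom_ext <;> simp [*]

/-- The product of two relations. -/
noncomputable def Relation.prod (hP : F.IsProper) {A B A' B' : C} (R : F.Relation A B)
    (S : F.Relation A' B') : F.Relation (A ⨯ A') (B ⨯ B') where
  apex := R.apex ⨯ S.apex
  l := prod.map R.l S.l
  r := prod.map R.r S.r
  mem := M_prod_map hP R S

theorem Relation.mem_prod_iff {A B A' B' X : C} {R : F.Relation A B} {S : F.Relation A' B'}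
    {x : X ⟶ A ⨯ A'} {y : X ⟶ B ⨯ B'} :
    (Relation.prod hP R S).Mem x y ↔
      R.Mem (x ≫ prod.fst) (y ≫ prod.fst) ∧ S.Mem (x ≫ prod.snd) (y ≫ prod.snd) := by
  constructor
  · intro h
    obtain ⟨d, rfl, rfl⟩ : ∃ d : X ⟶ R.apex ⨯ S.apex,
      d ≫ prod.map R.l S.l = x ∧ d ≫ prod.map R.r S.r = y := h
    exact ⟨⟨d ≫ prod.fst, by simp, by simp⟩, ⟨d ≫ prod.snd, by simp, by simp⟩⟩
  · rintro ⟨⟨d, hd₁, hd₂⟩, ⟨d', hd₁', hd₂'⟩⟩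
    refine ⟨prod.lift d d', ?_, ?_⟩ <;> apply Limits.prod.hom_ext <;> simp [Relation.prod, *]

/-- The product of two cells. -/
noncomputable def RelCell.prodMap {A B A' B' Z W Z' W' : C} {R : F.Relation A B}
    {S : F.Relation A' B'} {R' : F.Relation Z W} {S' : F.Relation Z' W'} {f : A ⟶ Z} {g : B ⟶ W}
    {f' : A' ⟶ Z'} {g' : B' ⟶ W'} (α : RelCell R R' f g) (β : RelCell S S' f' g') :
    RelCell (Relation.prod hP R S) (Relation.prod hP R' S') (prod.map f f') (prod.map g g') :=
  RelCell.ofMem fun x y h => by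
    rw [Relation.mem_prod_iff] at h ⊢
    simpa using And.intro (α.mem h.1) (β.mem h.2)

/-- The diagonal cell of a relation. -/
noncomputable def Relation.diagCell {A B : C} (R : F.Relation A B) :
    RelCell R (Relation.prod hP R R) (diag A) (diag B) :=
  RelCell.ofMem fun x y h => (Relation.mem_prod_iff hP).2 ⟨by simpa using h, by simpa using h⟩

theorem Relation.mem_prod_comp_iff (hS : F.IsStable) (hP : F.IsProper) {A B Z A' B' Z' : C}
    (R : F.Relation A B) (S : F.Relation B Z) (R' : F.Relation A' B') (S' : F.Relation B' Z')
    {X : C} (x : X ⟶ A ⨯ A') (z : X ⟶ Z ⨯ Z') :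
    ((Relation.prod hP R R').comp (Relation.prod hP S S')).Mem x z ↔
      (Relation.prod hP (R.comp S) (R'.comp S')).Mem x z := by
  constructor
  · intro h
    obtain ⟨Y, e, y, he, h₁, h₂⟩ := (mem_comp_iff hS).1 h
    rw [mem_prod_iff] at h₁ h₂ ⊢
    exact ⟨(mem_comp_iff hS).2 ⟨Y, e, _, he, by simpa using h₁.1, by simpa using h₂.1⟩,
      (mem_comp_iff hS).2 ⟨Y, e, _, he, by simpa using h₁.2, by simpa using h₂.2⟩⟩
  · intro h
    have : F.E.IsStableUnderBaseChange := hS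
    rw [mem_prod_iff] at h
    obtain ⟨Y, e, y, he, h₁, h₂⟩ := (mem_comp_iff hS).1 h.1
    obtain ⟨Y', e', y', he', h₁', h₂'⟩ := (mem_comp_iff hS).1 h.2
    -- The two factors supply intermediate elements on unrelated covers `e` and `e'`; their pullback
    -- is a common refinement.
    have hc : pullback.fst e e' ≫ e = pullback.snd e e' ≫ e' := pullback.condition
    refine (mem_comp_iff hS).2 ⟨pullback e e', pullback.fst e e' ≫ e,
      prod.lift (pullback.fst e e' ≫ y) (pullback.snd e e' ≫ y'),
      F.E_comp _ _ (MorphismProperty.pullback_fst _ _ he') he, ?_, ?_⟩ <;> rw [mem_prod_iff]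
    · refine ⟨by simpa using h₁.precomp (pullback.fst e e'), ?_⟩
      -- The refinement is written through `e`; the second factor needs it written through `e'`.
      rw [hc]
      simpa using h₁'.precomp (pullback.snd e e')
    · refine ⟨by simpa using h₂.precomp (pullback.fst e e'), ?_⟩
      rw [hc]
      simpa using h₂'.precomp (pullback.snd e e')

theorem Relation.mem_unit_prod_iff {A A' X : C} (x y : X ⟶ A ⨯ A') :
    Relation.Mem (F := F) ((F.rel hP).unit (A ⨯ A')) x y ↔
      (Relation.prod (F := F) hP ((F.rel hP).unit A) ((F.rel hP).unit A')).Mem x y := by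
  refine (mem_unit_iff hP).trans (Iff.trans ?_ (mem_prod_iff hP).symm)
  refine Iff.trans ?_ (and_congr (mem_unit_iff hP) (mem_unit_iff hP)).symm
  exact ⟨fun h => by simp [h], fun h => Limits.prod.hom_ext h.1 h.2⟩

/-- The product of relations, as a double functor. -/
noncomputable def relProd :
    DoubleCat.DoubleFunctor ((relDoubleCat hS hP).prod (relDoubleCat hS hP))
      (relDoubleCat hS hP) where
  obj :=
    { obj := fun p => p.1 ⨯ p.2
      map := fun f => prod.map f.1 f.2
      map_id := fun _ => prod.map_id_id
      map_comp := fun _ _ => (prod.map_map _ _ _ _).symm }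
  pro m := Relation.prod hP m.1 m.2
  cell α := RelCell.prodMap hP α.1 α.2
  compCell m n := (relGlobIso hP (Relation.mem_prod_comp_iff hS hP m.1 n.1 m.2 n.2)).hom
  idCell A := (relGlobIso hP (Relation.mem_unit_prod_iff hP (A := A.1) (A' := A.2))).hom
  cell_vid _ := (rel_isThin hP).eqCell prod.map_id_id prod.map_id_id
  cell_vcomp _ _ := (rel_isThin hP).eqCell (prod.map_map _ _ _ _).symm (prod.map_map _ _ _ _).symm
  compCell_invertible _ _ := ⟨_, rfl⟩
  idCell_invertible _ := ⟨_, rfl⟩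
  compCell_natural _ _ := (rel_isThin hP).eqCell (by simp) (by simp)
  idCell_natural _ := (rel_isThin hP).eqCell (by simp) (by simp)
  assoc_coherence _ _ _ := (rel_isThin hP).eqCell (by simp) (by simp)
  left_coherence _ := (rel_isThin hP).eqCell (by simp) (by simp)
  right_coherence _ := (rel_isThin hP).eqCell (by simp) (by simp)

/-- The product of relations is right adjoint to the diagonal. -/
noncomputable def relDiagonalAdjunction :
    DoubleCat.DoubleAdjunction (relDoubleCat hS hP).diagonal (relProd hS hP) where
  unit :=
    { app :=
        { app := fun A => diag A
          naturality := fun A B f => by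
            change f ≫ diag B = diag A ≫ prod.map f f
            simp }
      cell := fun m => Relation.diagCell (F := F) hP m
      natural := fun _ => (rel_isThin hP).eqCell (NatTrans.naturality _ _) (NatTrans.naturality _ _)
      hcomp_compat := fun _ _ => (rel_isThin hP).eqCell
        ((Category.comp_id _).trans (Category.id_comp _).symm)
        ((Category.comp_id _).trans (Category.id_comp _).symm)
      unit_compat := fun _ => (rel_isThin hP).eqCell
        ((Category.comp_id _).trans (Category.id_comp _).symm)
        ((Category.comp_id _).trans (Category.id_comp _).symm) }
  counit :=
    { app :=
        { app := fun p => (prod.fst, prod.snd)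
          naturality := fun p q f => Prod.ext (prod.map_fst _ _) (prod.map_snd _ _) }
      cell := fun m =>
        (RelCell.ofMem fun x y h => ((Relation.mem_prod_iff hP).1 h).1,
          RelCell.ofMem fun x y h => ((Relation.mem_prod_iff hP).1 h).2)
      natural := fun _ => (DoubleCat.prod_isThin (rel_isThin hP)).eqCell
        (NatTrans.naturality _ _) (NatTrans.naturality _ _)
      hcomp_compat := fun _ _ => (DoubleCat.prod_isThin (rel_isThin hP)).eqCell
        (by simp) (by simp)
      unit_compat := fun _ => (DoubleCat.prod_isThin (rel_isThin hP)).eqCell (by simp) (by simp) }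
  left_triangle_obj A := Prod.ext (prod.lift_fst _ _) (prod.lift_snd _ _)
  left_triangle_pro _ := (DoubleCat.prod_isThin (rel_isThin hP)).eqCell
    (Prod.ext (prod.lift_fst _ _) (prod.lift_snd _ _))
    (Prod.ext (prod.lift_fst _ _) (prod.lift_snd _ _))
  right_triangle_obj A := by
    change diag (A.1 ⨯ A.2) ≫ prod.map prod.fst prod.snd = 𝟙 _
    simp
  right_triangle_pro {A B} _ := (rel_isThin hP).eqCell
    (by change diag (A.1 ⨯ A.2) ≫ prod.map prod.fst prod.snd = 𝟙 _; simp)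
    (by change diag (B.1 ⨯ B.2) ≫ prod.map prod.fst prod.snd = 𝟙 _; simp)

/-- The terminal object with its identity relation, as a double functor. -/
noncomputable def relPoint : DoubleCat.DoubleFunctor DoubleCat.terminal (relDoubleCat hS hP) where
  obj := (Functor.const _).obj (⊤_ C)
  pro _ := (F.rel hP).unit (⊤_ C)
  cell _ := (F.rel hP).vid _
  -- The composite of two units is an image, only isomorphic to the unit, so the comparison is a
  -- unitor.
  compCell _ _ := ((relDoubleCat hS hP).coh.leftUnitor _).hom
  idCell _ := (F.rel hP).vid _
  cell_vid _ := (rel_isThin hP).eqCell (by simp) (by simp)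
  cell_vcomp _ _ := (rel_isThin hP).eqCell (by simp) (by simp)
  compCell_invertible _ _ := ⟨_, rfl⟩
  idCell_invertible _ := ⟨(relDoubleCat hS hP).vidIso _, rfl⟩
  compCell_natural _ _ := (rel_isThin hP).eqCell (by simp) (by simp)
  idCell_natural _ := (rel_isThin hP).eqCell (by simp) (by simp)
  assoc_coherence _ _ _ := (rel_isThin hP).eqCell (by simp) (by simp)
  left_coherence _ := (rel_isThin hP).eqCell (by simp) (by simp)
  right_coherence _ := (rel_isThin hP).eqCell (by simp) (by simp)

/-- The terminal object is right adjoint to the double functor to the terminal double category. -/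
noncomputable def relTerminalAdjunction :
    DoubleCat.DoubleAdjunction (relDoubleCat hS hP).toTerminal (relPoint hS hP) where
  unit :=
    { app :=
        { app := fun A => Limits.terminal.from A
          naturality := fun _ _ _ => terminal.hom_ext _ _ }
      cell := fun _ => RelCell.ofMem fun _ _ _ =>
        (mem_unit_iff hP).2 (terminal.hom_ext _ _)
      natural := fun _ => (rel_isThin hP).eqCell (terminal.hom_ext _ _) (terminal.hom_ext _ _)
      hcomp_compat := fun _ _ =>
        (rel_isThin hP).eqCell (terminal.hom_ext _ _) (terminal.hom_ext _ _)
      unit_compat := fun _ =>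
        (rel_isThin hP).eqCell (terminal.hom_ext _ _) (terminal.hom_ext _ _) }
  counit :=
    { app :=
        { app := fun _ => 𝟙 _
          naturality := fun _ _ _ => Subsingleton.elim _ _ }
      cell := fun _ => ⟨⟩
      natural := fun _ => DoubleCat.eqCell_terminal _ _
      hcomp_compat := fun _ _ => DoubleCat.eqCell_terminal _ _
      unit_compat := fun _ => DoubleCat.eqCell_terminal _ _ }
  left_triangle_obj _ := Subsingleton.elim _ _
  left_triangle_pro _ := DoubleCat.eqCell_terminal _ _
  right_triangle_obj _ := terminal.hom_ext _ _
  right_triangle_pro _ := (rel_isThin hP).eqCell (terminal.hom_ext _ _) (terminal.hom_ext _ _)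

theorem relDoubleCat_isCartesian : (relDoubleCat hS hP).IsCartesian :=
  ⟨⟨relProd hS hP, ⟨relDiagonalAdjunction hS hP⟩⟩, ⟨relPoint hS hP, ⟨relTerminalAdjunction hS hP⟩⟩⟩

/-! ### Tabulators -/

/-- The apex of a relation, as a functor. -/
noncomputable def relApex : (relDoubleCat hS hP).Proarrow ⥤ C where
  obj m := Relation.apex (F := F) m.pro
  map s := RelCell.hom (F := F) s.cell
  map_id _ := rfl
  map_comp _ _ := rfl

/-- The apex of a relation is its tabulator. -/
noncomputable def relTabulator : (relDoubleCat hS hP).y ⊣ relApex hS hP :=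
  Adjunction.mkOfUnitCounit
    { unit :=
        -- The apex of `y_A` is `A` itself, so the unit is the identity. The counit at a relation is
        -- its generic element: the two legs, with the identity of the apex between them.
        { app := fun A => 𝟙 A
          naturality := fun _ _ f => (Category.comp_id f).trans (Category.id_comp f).symm }
      counit :=
        { app := fun m => ⟨Relation.l (F := F) m.pro, Relation.r (F := F) m.pro,
            ⟨𝟙 _, rfl, rfl⟩⟩
          naturality := fun m n s => (relDoubleCat_isThin hS hP).eqCell
            (RelCell.hom_l (F := F) s.cell) (RelCell.hom_r (F := F) s.cell) }
      left_triangle := by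
        ext A
        have h : 𝟙 A ≫ 𝟙 A ≫ 𝟙 A = 𝟙 A := by simp
        exact (relDoubleCat_isThin hS hP).eqCell h h
      right_triangle := by
        ext m
        change 𝟙 (Relation.apex (F := F) m.pro) ≫ 𝟙 _ ≫ 𝟙 _ = 𝟙 _
        simp }

theorem relDoubleCat_hasTabulators : (relDoubleCat hS hP).HasTabulators :=
  (relTabulator hS hP).isLeftAdjoint

/-- Together with unit-purity this makes `y` fully faithful, whence the unit of `y ⊣ ⊤` is
invertible. -/
theorem y_faithful : (relDoubleCat hS hP).y.Faithful where
  map_injective h := congrArg Sq.left h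

/-- Every tabulator of a relation is isomorphic to its apex. -/
theorem exists_iso_apex {T : (relDoubleCat hS hP).Proarrow ⥤ C} (adj : (relDoubleCat hS hP).y ⊣ T)
    (m : (relDoubleCat hS hP).Proarrow) :
    ∃ i : T.obj m ≅ Relation.apex (F := F) m.pro,
      (adj.counit.app m).left = i.hom ≫ Relation.l (F := F) m.pro ∧
      (adj.counit.app m).right = i.hom ≫ Relation.r (F := F) m.pro := by
  -- The comparison of right adjoints respects the counits; the two sides of this equation of cells
  -- are the formulas for the legs.
  have h := Adjunction.rightAdjointUniq_hom_app_counit adj (relTabulator hS hP) m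
  refine ⟨(adj.rightAdjointUniq (relTabulator hS hP)).app m, ?_, ?_⟩
  · exact (congrArg Sq.left h).symm
  · exact (congrArg Sq.right h).symm

/-! ### Strength of tabulators and kernels of their legs -/

theorem Relation.M_iso_comp {A B T : C} (R : F.Relation A B) (i : T ≅ R.apex) :
    F.M (prod.lift (i.hom ≫ R.l) (i.hom ≫ R.r)) := by
  rw [← prod.comp_lift]
  exact F.M_comp _ _ (F.M_of_isIso _ inferInstance) R.mem

theorem Relation.exists_of_mem_iso {A B T X : C} (R : F.Relation A B) (i : T ≅ R.apex) {x : X ⟶ A}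
    {y : X ⟶ B} (h : R.Mem x y) : ∃ d : X ⟶ T, d ≫ i.hom ≫ R.l = x ∧ d ≫ i.hom ≫ R.r = y := by
  obtain ⟨d, rfl, rfl⟩ := h
  exact ⟨d ≫ i.inv, by simp, by simp⟩

-- By thinness only an inclusion of `m` in `l^* ⊗ r_!` is needed. For an element `(d ≫ l, d ≫ r)` of
-- `m` the intermediate element is `d`: the cells `η` put `(d ≫ l, d)` in `l^*` and `(d, d ≫ r)` in
-- `r_!`, whichever conjoint and companion are chosen.
variable {hS hP} in
theorem isCanonicalExtension_of_mem {T A B : C} {m : F.Relation A B} {l : T ⟶ A} {r : T ⟶ B}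
    (τ : (relDoubleCat hS hP).Cell ((relDoubleCat hS hP).unit T) m l r)
    (h : ∀ {X : C} (x : X ⟶ A) (y : X ⟶ B), m.Mem x y → ∃ d : X ⟶ T, d ≫ l = x ∧ d ≫ r = y) :
    DoubleCat.IsCanonicalExtension τ := by
  intro cl cr
  refine DoubleCat.hor_isIso (relDoubleCat_isThin hS hP) _ (horHom hS hP fun x y hxy => ?_)
  obtain ⟨d, rfl, rfl⟩ := h x y hxy
  have hd := (mem_unit_iff (F := F) hP (x := d)).2 rfl
  have h₁ := RelCell.mem cl.η hd
  have h₂ := RelCell.mem cr.η hd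
  rw [Category.comp_id] at h₁ h₂
  exact Relation.mem_comp_of_mem h₁ h₂

/-- On a cover, the cells `ε` into the unit identify both `x ≫ f` and `y ≫ f` with the intermediate
element. The cover is an epimorphism, so they agree already before it. -/
theorem eq_of_mem_kernel {T A X : C} {f : T ⟶ A} (c : (relDoubleCat hS hP).Companion f)
    (c' : (relDoubleCat hS hP).Conjoint f) {x y : X ⟶ T}
    (h : Relation.Mem (F := F) ((F.rel hP).hcompPro c.pro c'.pro) x y) : x ≫ f = y ≫ f := by
  obtain ⟨Y, e, z, he, h₁, h₂⟩ := (Relation.mem_comp_iff hS).1 h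
  have := hP.epi e he
  have h₁' := (mem_unit_iff hP).1 (RelCell.mem c.ε h₁)
  have h₂' := (mem_unit_iff hP).1 (RelCell.mem c'.ε h₂)
  rw [← cancel_epi e, ← Category.assoc, h₁', h₂', Category.assoc]

/-- The inverse cell is the inclusion of the product in the diagonal: by the two projections, a pair
in it is identified by `l` and by `r`, hence is a pair of equal elements. -/
theorem jointKernelTrivial_of_mono {T A B : C} {l : T ⟶ A} {r : T ⟶ B}
    (h : Mono (prod.lift l r)) : (relDoubleCat hS hP).JointKernelTrivial l r := by
  intro cl cl' cr cr' P hP'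
  refine DoubleCat.hor_isIso (relDoubleCat_isThin hS hP) _ (horHom hS hP fun x y hxy => ?_)
  refine (mem_unit_iff hP).2 ?_
  have hl := eq_of_mem_kernel hS hP cl cl' (mem_of_horHom hS hP P.fst hxy)
  have hr := eq_of_mem_kernel hS hP cr cr' (mem_of_horHom hS hP P.snd hxy)
  rw [← cancel_mono (prod.lift l r)]
  apply Limits.prod.hom_ext <;> simpa

end OrthogonalFactorizationSystem

theorem mainTheorem9 {C : Type u} [Category.{v} C] [HasFiniteLimits C]
    (F : OrthogonalFactorizationSystem C) (hS : F.IsStable) (hP : F.IsProper) :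
    ∃ D : DoubleCat.{v, u, max u v, v} C, D.toDoubleData = F.rel hP ∧
      D.IsUnitPure ∧ D.IsEquipment ∧ D.IsCartesian ∧ D.HasLocalProducts ∧ D.HasTabulators ∧
      ∀ (T : D.Proarrow ⥤ C) (adj : D.y ⊣ T), IsIso adj.unit ∧
        ∀ m : D.Proarrow,
          DoubleCat.IsCanonicalExtension (adj.counit.app m).cell ∧
          F.M (prod.lift (adj.counit.app m).left (adj.counit.app m).right) ∧
          D.JointKernelTrivial (adj.counit.app m).left (adj.counit.app m).right := by
  open OrthogonalFactorizationSystem in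
  refine ⟨relDoubleCat hS hP, rfl, relDoubleCat_isUnitPure hS hP, relDoubleCat_isEquipment hS hP,
    relDoubleCat_isCartesian hS hP, relDoubleCat_hasLocalProducts hS hP,
    relDoubleCat_hasTabulators hS hP, fun T adj => ⟨?_, fun m => ?_⟩⟩
  -- The unit of an adjunction with fully faithful left adjoint is invertible.
  · have : (relDoubleCat hS hP).y.Full := relDoubleCat_isUnitPure hS hP
    have := y_faithful hS hP
    infer_instance
  -- The tabulator is arbitrary; through `i` its legs become those of the relation `m`.
  · obtain ⟨i, hl, hr⟩ := exists_iso_apex hS hP adj m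
    have hM : F.M (prod.lift (adj.counit.app m).left (adj.counit.app m).right) := by
      rw [hl, hr]
      exact Relation.M_iso_comp (F := F) m.pro i
    refine ⟨isCanonicalExtension_of_mem _ ?_, hM, jointKernelTrivial_of_mono hS hP (hP.mono _ hM)⟩
    rw [hl, hr]
    exact fun x y h => Relation.exists_of_mem_iso (F := F) m.pro i h
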